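/- Let $N=2^J$ with an integer $J\ge 1$, and let $x\in\mathbb R^N$ have a short support of length $m\ge 1$: there are indices $\mu\le\nu=\mu+m-1$ in $\{0,\dots,N-1\}$ with $x_\mu\ne0$, $x_\nu\ne0$ and $x_k=0$ for all $k\notin\{\mu,\dots,\nu\}$. Suppose that $x_\mu+x_\nu\neq 0$ if $m$ is even. Let $x^{\widehat{\mathrm{II}}}=\mathbf C^{\mathrm{II}}_N x$ with $\mathbf C^{\mathrm{II}}_N=\sqrt{2/N}\,\bigl(\varepsilon_N(k)\cos\frac{k(2l+1)\pi}{2N}\bigr)_{k,l=0}^{N-1}$, where $\varepsilon_N(0)=1/\sqrt2$ and $\varepsilon_N(k)=1$ for $0<k<N$. Let an integer $M\ge m$ be known ($\mu$, $\nu$, $m$ are not), and put $L=\min\{\lceil\log_2M\rceil+1,\,J\}$. Define the reflected periodizations of $x$ by $x^{(J)}=x$ and $x^{(j)}_k=x^{(j+1)}_k+x^{(j+1)}_{2^{j+1}-1-k}$ for $0\le k<2^j$. Let $\varepsilon\ge0$ be a threshold that is smaller than the modulus of every nonzero entry of $x^{(L)},\dots,x^{(J)}$ (for instance $\varepsilon=0$).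 Consider the following algorithm, whose input is $J$, $M$, $\varepsilon$ and access to single entries (samples) of $x^{\widehat{\mathrm{II}}}$. Vectors with short support are stored as first support index, support length and entries on the support interval; to find the support of a computed vector means to find the first and the last entry of modulus greater than $\varepsilon$. 1. Compute $x^{(L)}=\bigl(\mathbf C^{\mathrm{II}}_{2^L}\bigr)^{T}\bigl(\sqrt2^{\,J-L}x^{\widehat{\mathrm{II}}}_{2^{J-L}k}\bigr)_{k=0}^{2^L-1}$ by a fast cosine transform of type III, and find its first support index $\mu^{(L)}$ and support length $m^{(L)}$. 2. For $j=L,\dots,J-1$: (a) If $\mu^{(j)}<2^j-M$, let $\alpha=\sqrt2^{\,J-j-1}x^{\widehat{\mathrm{II}}}_{2^{J-j-1}(2k_0+1)}$ be of largest modulus among these numbers for $0\le k_0<m^{(j)}$, and let $u=2^{-j/2}\sum_{l=0}^{m^{(j)}-1}\cos\frac{(2k_0+1)(2(\mu^{(j)}+l)+1)\pi}{2\cdot2^{j+1}}\,x^{(j)}_{\mu^{(j)}+l}$. If $|u-\alpha|<|u+\alpha|$, then $x^{(j+1)}$ is $x^{(j)}$ followed by $2^j$ zeros; otherwise it consists of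 $2^j$ zeros followed by the reversal of $x^{(j)}$, with first support index $2^{j+1}-m^{(j)}-\mu^{(j)}$. In both cases $m^{(j+1)}=m^{(j)}$. (b) Otherwise let $K=\lceil\log_2(2^j-\mu^{(j)})\rceil+1$ and $n=2^{K-1}$, let $z$ consist of the last $n$ entries of $x^{(j)}$, let $b^{0},b^{1}\in\mathbb R^n$ have the entries $\sqrt2^{\,J-j-1}x^{\widehat{\mathrm{II}}}_{2^{J-K}(2p+1)\pm2^{J-j-1}}$, $0\le p<n$ (with $+$ for $b^0$ and $-$ for $b^1$), and let $$z_{(0)}=\tfrac12\sqrt{2^{j-K}}\,(-1)^{2^{j-K}}\,\mathbf J\,\mathrm{diag}\Bigl(\frac{(-1)^k}{\cos((2k+1)\pi/(4\cdot2^j))}\Bigr)_{k=0}^{n-1}\mathbf C^{\mathrm{IV}}_n\,\mathbf J\,(b^0-b^1)+\tfrac12z ,$$ where $\mathbf J$ reverses a vector and $\mathbf C^{\mathrm{IV}}_n=\sqrt{2/n}\bigl(\cos\frac{(2k+1)(2l+1)\pi}{4n}\bigr)_{k,l=0}^{n-1}$ is applied by a fast cosine transform of type IV. Set the entries of $z_{(0)}$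 of modulus at most $\varepsilon$ to zero and let $z_{(1)}=\mathbf J(z-z_{(0)})$. Then $x^{(j+1)}$ has the entries of $z_{(0)}$ at the positions $2^j-n,\dots,2^j-1$, those of $z_{(1)}$ at the positions $2^j,\dots,2^j+n-1$, and zeros elsewhere; find its first support index $\mu^{(j+1)}$ and support length $m^{(j+1)}$. 3. Return $x^{(J)}$. In exact real arithmetic, this algorithm recovers $x$. Its runtime, that is, the number of elementary operations (arithmetic operations, square roots, evaluations of cosines and comparisons of real numbers, operations on indices, samples, and steps of data movement and control), is $\mathcal O\bigl(M\log M+m\log_2\frac NM\bigr)$, and it uses $\mathcal O\bigl(M+m\log_2\frac NM\bigr)$ samples of $x^{\widehat{\mathrm{II}}}$, all at indices in $\{0,\dots,N-1\}$. The implied constants are absolute: they do not depend on $J$, $x$, $m$, $M$ or $\varepsilon$. -/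

import Mathlib

/-! ### The cosine transform, short support and reflected periodizations -/

/-- The cosine matrix of type II,
`√(2/n) · (ε_n(k) cos (k (2l+1) π / (2n)))` with `ε_n(k) = 1/√2` if `n ∣ k`, else `1`. -/
noncomputable def cosMatrixII (n : ℕ) : Matrix (Fin n) (Fin n) ℝ :=
  Matrix.of fun k l =>
    Real.sqrt (2 / n) * (if (k : ℕ) % n = 0 then 1 / Real.sqrt 2 else 1) *
      Real.cos ((k : ℝ) * (2 * (l : ℝ) + 1) * Real.pi / (2 * (n : ℝ)))

/-- The discrete cosine transform of type II. -/
noncomputable def dctII {n : ℕ} (x : Fin n → ℝ) : Fin n → ℝ :=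
  (cosMatrixII n).mulVec x

/-- A vector as a function on all indices, zero outside its range. -/
def zeroExtend {n : ℕ} (x : Fin n → ℝ) (i : ℕ) : ℝ :=
  if h : i < n then x ⟨i, h⟩ else 0

/-- `x` has a short (one-block) support of length `m`, with first support index `μ` and last
support index `ν = μ + m - 1`. -/
structure HasShortSupport {n : ℕ} (x : Fin n → ℝ) (μ ν : Fin n) (m : ℕ) : Prop where
  le : μ ≤ ν
  length : (ν : ℕ) + 1 = (μ : ℕ) + m
  first_ne : x μ ≠ 0
  last_ne : x ν ≠ 0
  zero_off : ∀ k, k < μ ∨ ν < k → x k = 0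

/-- The `d`-fold reflected periodization of a vector of length `2 ^ J`: the vector `x^(J-d)`, where
`x^(J) = x` and `x^(j)_k = x^(j+1)_k + x^(j+1)_{2^(j+1)-1-k}` for `k < 2 ^ j`. -/
def reflPeriodAux {J : ℕ} (x : Fin (2 ^ J) → ℝ) : ℕ → ℕ → ℝ
  | 0 => zeroExtend x
  | d + 1 => fun k =>
      if k < 2 ^ (J - (d + 1)) then
        reflPeriodAux x d k + reflPeriodAux x d (2 ^ (J - (d + 1) + 1) - 1 - k)
      else 0

/-- The reflected periodization `x^(j)`, for `j ≤ J`, as a function on all indices that vanishes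
from `2 ^ j` on. -/
def reflPeriod {J : ℕ} (x : Fin (2 ^ J) → ℝ) (j : ℕ) : ℕ → ℝ :=
  reflPeriodAux x (J - j)

/-! ### A real-number machine with unit costs

Programs have no access to the input vector except through the instruction `sample`. Every
instruction costs one step. Lists are linked lists: a `tick` is charged for every cell that is
inspected or created, for every loop iteration and for every procedure call. -/

inductive RealOp
  | add | sub | mul | div

noncomputable def RealOp.eval : RealOp → ℝ → ℝ → ℝ
  | .add, a, b => a + b
  | .sub, a, b => a - b
  | .mul, a, b => a * b
  | .div, a, b => a / b

/-- Index arithmetic; `shl a b` is the left shift `a * 2 ^ b`. -/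
inductive NatOp
  | add | sub | mul | shl

def NatOp.eval : NatOp → ℕ → ℕ → ℕ
  | .add, a, b => a + b
  | .sub, a, b => a - b
  | .mul, a, b => a * b
  | .shl, a, b => a * 2 ^ b

/-- The instructions, indexed by the type of their results. -/
inductive Instr : Type → Type
  /-- one step of control or data movement -/
  | tick : Instr Unit
  /-- read one entry of the input vector -/
  | sample (i : ℕ) : Instr ℝ
  | real (op : RealOp) (a b : ℝ) : Instr ℝ
  | abs (a : ℝ) : Instr ℝ
  | sqrt (a : ℝ) : Instr ℝ
  /-- the number `cos (p π / q)` -/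
  | cosPi (p q : ℕ) : Instr ℝ
  /-- conversion of an index to a real number -/
  | cast (a : ℕ) : Instr ℝ
  /-- the test `a < b` on real numbers -/
  | ltReal (a b : ℝ) : Instr Bool
  | nat (op : NatOp) (a b : ℕ) : Instr ℕ
  /-- the number `⌈log₂ a⌉` -/
  | clog (a : ℕ) : Instr ℕ
  /-- the test `a < b` on indices -/
  | ltNat (a b : ℕ) : Instr Bool

/-- The result of an instruction on the input vector `y`. -/
noncomputable def Instr.exec (y : ℕ → ℝ) : {β : Type} → Instr β → β
  | _, .tick => ()
  | _, .sample i => y i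
  | _, .real op a b => op.eval a b
  | _, .abs a => |a|
  | _, .sqrt a => Real.sqrt a
  | _, .cosPi p q => Real.cos ((p : ℝ) * Real.pi / (q : ℝ))
  | _, .cast a => (a : ℝ)
  | _, .ltReal a b => decide (a < b)
  | _, .nat op a b => op.eval a b
  | _, .clog a => Nat.clog 2 a
  | _, .ltNat a b => decide (a < b)

/-- The positions of the input vector that an instruction reads. -/
def Instr.reads : {β : Type} → Instr β → List ℕ
  | _, .sample i => [i]
  | _, _ => []

/-- Programs with result type `α`: sequences of instructions, each of which may depend on the
results of the earlier ones. -/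
inductive Prog (α : Type) : Type 1
  | ret (a : α) : Prog α
  | instr {β : Type} (i : Instr β) (next : β → Prog α) : Prog α

def Prog.seq {α γ : Type} : Prog α → (α → Prog γ) → Prog γ
  | .ret a, f => f a
  | .instr i next, f => .instr i fun b => (next b).seq f

instance : Monad Prog where
  pure := Prog.ret
  bind := Prog.seq

/-- What a run produces: the result, the number of executed instructions, and the list of the
positions that were sampled (with repetitions). -/
structure Outcome (α : Type) where
  val : α
  steps : ℕ
  samples : List ℕ

noncomputable def Prog.run {α : Type} (y : ℕ → ℝ) : Prog α → Outcome α
  | .ret a => ⟨a, 0, []⟩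
  | .instr i next =>
      let r := Prog.run y (next (i.exec y))
      ⟨r.val, r.steps + 1, i.reads ++ r.samples⟩

namespace Prog

def perform {β : Type} (i : Instr β) : Prog β := .instr i .ret

def tick : Prog Unit := perform .tick
def sample (i : ℕ) : Prog ℝ := perform (.sample i)
def radd (a b : ℝ) : Prog ℝ := perform (.real .add a b)
def rsub (a b : ℝ) : Prog ℝ := perform (.real .sub a b)
def rmul (a b : ℝ) : Prog ℝ := perform (.real .mul a b)
def rdiv (a b : ℝ) : Prog ℝ := perform (.real .div a b)
def rabs (a : ℝ) : Prog ℝ := perform (.abs a)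
def rsqrt (a : ℝ) : Prog ℝ := perform (.sqrt a)
def cosPi (p q : ℕ) : Prog ℝ := perform (.cosPi p q)
def cast (a : ℕ) : Prog ℝ := perform (.cast a)
def rlt (a b : ℝ) : Prog Bool := perform (.ltReal a b)
def nadd (a b : ℕ) : Prog ℕ := perform (.nat .add a b)
def nsub (a b : ℕ) : Prog ℕ := perform (.nat .sub a b)
def nmul (a b : ℕ) : Prog ℕ := perform (.nat .mul a b)
def shl (a b : ℕ) : Prog ℕ := perform (.nat .shl a b)
def clog (a : ℕ) : Prog ℕ := perform (.clog a)
def nlt (a b : ℕ) : Prog Bool := perform (.ltNat a b)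

/-! #### List procedures -/

def cons (a : ℝ) (l : List ℝ) : Prog (List ℝ) := do
  tick
  return a :: l

def map (f : ℝ → Prog ℝ) : List ℝ → Prog (List ℝ)
  | [] => do tick; return []
  | a :: l => do
      tick
      let b ← f a
      let r ← map f l
      cons b r

def zipWith (f : ℝ → ℝ → Prog ℝ) : List ℝ → List ℝ → Prog (List ℝ)
  | a :: l, b :: l' => do
      tick
      let c ← f a b
      let r ← zipWith f l l'
      cons c r
  | _, _ => do tick; return []

/-- `rev l acc` is the reversal of `l` followed by `acc`. -/
def rev : List ℝ → List ℝ → Prog (List ℝ)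
  | [], acc => do tick; return acc
  | a :: l, acc => do
      tick
      let acc' ← cons a acc
      rev l acc'

def append : List ℝ → List ℝ → Prog (List ℝ)
  | [], l' => do tick; return l'
  | a :: l, l' => do
      tick
      let r ← append l l'
      cons a r

/-- `n` zeros. -/
def zeros : ℕ → Prog (List ℝ)
  | 0 => do tick; return []
  | n + 1 => do
      tick
      let r ← zeros n
      cons 0 r

def length : List ℝ → Prog ℕ
  | [] => do tick; return 0
  | _ :: l => do
      tick
      let n ← length l
      nadd n 1

/-- The lists of the entries with even and with odd position. -/
def evenOdd : List ℝ → Prog (List ℝ × List ℝ)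
  | [] => do tick; return ([], [])
  | a :: l => do
      tick
      let p ← evenOdd l
      let e ← cons a p.2
      return (e, p.1)

/-- `√2 ^ d`, as `√(2 ^ d)`. -/
def sqrtTwoPow (d : ℕ) : Prog ℝ := do
  let n ← shl 1 d
  let a ← cast n
  rsqrt a

/-! #### Fast cosine transforms of types III and IV

The length is `2 ^ e`. The transform of type III of length `2n` is computed from the transforms of
types III and IV of length `n` of the entries with even and with odd position, and the one of
type IV of length `n` from the one of type III of the same length, by
`2 cos ((2k+1)π/(4n)) cos ((2k+1)(2l+1)π/(4n)) =
cos ((2k+1)(l+1)π/(2n)) + cos ((2k+1)lπ/(2n))`. -/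

/-- `(prev + a₀, a₀ + a₁, a₁ + a₂, …)` -/
def pairSums : ℝ → List ℝ → Prog (List ℝ)
  | _, [] => do tick; return []
  | prev, a :: l => do
      tick
      let s ← radd prev a
      let r ← pairSums a l
      cons s r

/-- `(√2 a₀, a₀ + a₁, a₁ + a₂, …)` -/
def prepareIV : List ℝ → Prog (List ℝ)
  | [] => do tick; return []
  | a :: l => do
      tick
      let s ← sqrtTwoPow 1
      let b ← rmul s a
      let r ← pairSums a l
      cons b r

/-- Divides the entry with position `k` by `2 cos ((p + 2k) π / q)`. -/
def divTwoCos (q : ℕ) : ℕ → List ℝ → Prog (List ℝ)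
  | _, [] => do tick; return []
  | p, a :: l => do
      tick
      let c ← cosPi p q
      let d ← radd c c
      let b ← rdiv a d
      let p' ← nadd p 2
      let r ← divTwoCos q p' l
      cons b r

/-- The transform of type IV of length `2 ^ e`, by means of a procedure `f` for the transform of
type III of the same length. -/
def dctIVUsing (f : List ℝ → Prog (List ℝ)) (e : ℕ) (l : List ℝ) : Prog (List ℝ) := do
  tick
  let w ← prepareIV l
  let v ← f w
  let q ← shl 4 e
  divTwoCos q 1 v

/-- The fast transform of type III of length `2 ^ e`. -/
def dctIII : ℕ → List ℝ → Prog (List ℝ)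
  | 0, l => do tick; return l
  | e + 1, l => do
      tick
      let p ← evenOdd l
      let a ← dctIII e p.1
      let b ← dctIVUsing (dctIII e) e p.2
      let s ← sqrtTwoPow 1
      let sum ← zipWith (fun u v => do let w ← radd u v; rdiv w s) a b
      let dif ← zipWith (fun u v => do let w ← rsub u v; rdiv w s) a b
      let dif' ← rev dif []
      append sum dif'

/-- The fast transform of type IV of length `2 ^ e`. -/
def dctIV (e : ℕ) (l : List ℝ) : Prog (List ℝ) := dctIVUsing (dctIII e) e l

end Prog

/-! ### The sparse cosine transform for bounded short support length -/

/-- A vector with one-block support, stored as its first support index, its support length and its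
entries on the support interval. -/
structure Block where
  first : ℕ
  len : ℕ
  vals : List ℝ

/-- The vector of length `n` that a block stands for. -/
def Block.toVec (B : Block) (n : ℕ) : Fin n → ℝ := fun k =>
  if B.first ≤ (k : ℕ) then B.vals.getD ((k : ℕ) - B.first) 0 else 0

/-- The level `L = ⌈log₂ M⌉ + 1` at which the algorithm starts, or `J` if that is smaller. -/
def startLevel (J M : ℕ) : ℕ := min (Nat.clog 2 M + 1) J

namespace SparseDCT

open Prog

/-- The numbers `s * y_i` for `n` sampling positions `i = start, start + stride, …`. -/
def samples (s : ℝ) (stride : ℕ) : ℕ → ℕ → Prog (List ℝ)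
  | 0, _ => do tick; return []
  | n + 1, start => do
      tick
      let v ← sample start
      let a ← rmul s v
      let next ← nadd start stride
      let r ← samples s stride n next
      cons a r

/-- Drops the leading entries of modulus at most `ε`, and advances the index `i` past them. -/
def dropSmall (ε : ℝ) : ℕ → List ℝ → Prog (ℕ × List ℝ)
  | i, [] => do tick; return (i, [])
  | i, a :: l => do
      tick
      let v ← rabs a
      let big ← rlt ε v
      if big then return (i, a :: l)
      else do
        let i' ← nadd i 1
        dropSmall ε i' l

/-- The block of a vector that is zero except for the entries `l` at the positions from `base` on:
the support interval runs from the first to the last entry of modulus greater than `ε`. -/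
def findSupport (ε : ℝ) (base : ℕ) (l : List ℝ) : Prog Block := do
  let p ← dropSmall ε base l
  let r ← rev p.2 []
  let q ← dropSmall ε 0 r
  let v ← rev q.2 []
  let len ← length v
  return ⟨p.1, len, v⟩

/-- The entry of largest modulus in a list, together with its label `k`; the labels of the entries
are `k, k + 2, k + 4, …`, and `(bestK, best)` is the best entry seen so far. -/
def argmaxAbs : ℕ → ℕ → ℝ → List ℝ → Prog (ℕ × ℝ)
  | _, bestK, best, [] => do tick; return (bestK, best)
  | k, bestK, best, a :: l => do
      tick
      let u ← rabs a
      let v ← rabs best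
      let better ← rlt v u
      let k' ← nadd k 2
      if better then argmaxAbs k' k a l else argmaxAbs k' bestK best l

/-- `∑_l cos (κ (t + 2l) π / q) a_l` -/
def cosSum (κ q : ℕ) : ℕ → List ℝ → Prog ℝ
  | _, [] => do tick; return 0
  | t, a :: l => do
      tick
      let p ← nmul κ t
      let c ← cosPi p q
      let b ← rmul c a
      let t' ← nadd t 2
      let r ← cosSum κ q t' l
      radd b r

/-- Multiplies the entry with position `k` by `(-1)^k s / cos ((p + 2k) π / q)`. -/
def signedSec (q : ℕ) : ℝ → ℕ → List ℝ → Prog (List ℝ)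
  | _, _, [] => do tick; return []
  | s, p, a :: l => do
      tick
      let c ← cosPi p q
      let d ← rdiv a c
      let b ← rmul s d
      let s' ← rsub 0 s
      let p' ← nadd p 2
      let r ← signedSec q s' p' l
      cons b r

/-- The iteration step from level `j` to level `j + 1` if the support is not contained in the last
`M` entries. -/
def stepNoCollision (J j : ℕ) (B : Block) : Prog Block := do
  tick
  let j1 ← nadd j 1
  let d ← nsub J j1
  let s ← sqrtTwoPow d
  let start ← shl 1 d
  let stride ← shl 2 d
  let ys ← samples s stride B.len start
  -- `best = (2 k₀ + 1, α)`
  let best ← argmaxAbs 1 1 0 ys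
  let t0 ← nmul 2 B.first
  let t ← nadd t0 1
  let q ← shl 4 j
  let sum ← cosSum best.1 q t B.vals
  let root ← sqrtTwoPow j
  let u ← rdiv sum root
  let dm ← rsub u best.2
  let dp ← radd u best.2
  let am ← rabs dm
  let ap ← rabs dp
  let same ← rlt am ap
  if same then return B
  else do
    let n ← shl 1 j1
    let n' ← nsub n B.len
    let first ← nsub n' B.first
    let vals ← rev B.vals []
    return ⟨first, B.len, vals⟩

/-- The iteration step from level `j` to level `j + 1` if the support is contained in the last `M`
entries, where nonzero entries may have been added. -/
def stepCollision (J : ℕ) (ε : ℝ) (j : ℕ) (B : Block) : Prog Block := do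
  tick
  let n ← shl 1 j
  let mt ← nsub n B.first
  let e ← clog mt
  let K ← nadd e 1
  let w ← shl 1 e
  -- the last `2 ^ (K - 1)` entries `z` of the current periodization
  let right ← nsub mt B.len
  let zr ← zeros right
  let z1 ← append B.vals zr
  let left ← nsub w mt
  let zl ← zeros left
  let z ← append zl z1
  -- the samples `b⁰` and `b¹`
  let j1 ← nadd j 1
  let d ← nsub J j1
  let s ← sqrtTwoPow d
  let e' ← nsub J K
  let mid ← shl 1 e'
  let stride ← shl 2 e'
  let off ← shl 1 d
  let i0 ← nadd mid off
  let i1 ← nsub mid off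
  let b0 ← samples s stride w i0
  let b1 ← samples s stride w i1
  -- the last `2 ^ (K - 1)` entries `z0` of the first half of the next periodization
  let b ← zipWith rsub b0 b1
  let b' ← rev b []
  let v ← dctIV e b'
  let q ← shl 4 j
  let v' ← signedSec q 1 1 v
  let v'' ← rev v' []
  let h ← nsub j K
  let root ← sqrtTwoPow h
  let half ← rdiv 1 2
  let c0 ← rmul half root
  let pos ← nlt 0 h
  let c ← if pos then pure c0 else rsub 0 c0
  let z0' ← zipWith (fun a a' => do
    let f ← rmul c a
    let g ← rmul half a'
    radd f g) v'' z
  let z0 ← map (fun a => do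
    let f ← rabs a
    let big ← rlt ε f
    if big then pure a else pure 0) z0'
  -- the first `2 ^ (K - 1)` entries of the second half
  let z1' ← zipWith rsub z z0
  let z1'' ← rev z1' []
  let both ← append z0 z1''
  let base ← nsub n w
  findSupport ε base both

/-- The iteration over `r` levels from level `j` on. -/
def levels (J M : ℕ) (ε : ℝ) : ℕ → ℕ → Block → Prog Block
  | 0, _, B => do tick; return B
  | r + 1, j, B => do
      tick
      let n ← shl 1 j
      let bd ← nadd B.first M
      let noColl ← nlt bd n
      let B' ← if noColl then stepNoCollision J j B else stepCollision J ε j B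
      let j' ← nadd j 1
      levels J M ε r j' B'

/-- The whole algorithm, for vectors of length `2 ^ J`, support lengths up to `M` and the noise
threshold `ε`. It samples the transform of type II of the vector that it recovers. -/
def algorithm (J M : ℕ) (ε : ℝ) : Prog Block := do
  let e ← clog M
  let L0 ← nadd e 1
  let small ← nlt L0 J
  let L ← if small then pure L0 else pure J
  let d ← nsub J L
  let s ← sqrtTwoPow d
  let stride ← shl 1 d
  let count ← shl 1 L
  let ys ← samples s stride count 0
  let xs ← dctIII L ys
  let B ← findSupport ε 0 xs
  levels J M ε d L B

end SparseDCT

/-!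
The algorithm recovers `x` because the transforms of all reflected periodizations `x^(j)` are
contained in the transform of `x` (`c2_reflPeriod`): the coefficients of even index of `x^(j+1)`
are those of `x^(j)`, and the coefficients of odd index determine the difference of the first half
and the mirrored second half (`c2_two_mul_add_one`).

Folding a vector with short support keeps the support short, and the condition on `x_μ + x_ν`
excludes that the boundary entries cancel (`IsShort.folded`). Therefore `x^(j+1)` is `x^(j)` in one
of the two halves, unless its support meets the middle, which puts the support of `x^(j)` into the
last `m` entries. In the first situation all coefficients of odd index are determined up to a
common sign; one of the first `m` of them is nonzero, by a Vandermonde argument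
(`exists_sum_cos_odd_ne`), and shows the sign. In the second situation, differences of neighbouring
odd coefficients at equidistant positions are a transform of type IV of the antisymmetric part
(`c2_odd_sub`), which is inverted since this transform is an involution (`c4_c4`).

For the costs, the procedure for the second situation runs at most once (`run_levels`): after it the
support has the distance `M` from both ends of the vector, and this persists (`run_levels_of_lt`). All other
steps cost `O(m)`, the two fast transforms of length `O(M)` cost `O(M log M)` (`run_dctIII_tab`),
and at most `log₂ (N / M)` levels are passed. Programs are evaluated symbolically: the lemmas
`run_…` give the result, the number of steps and the samples of each procedure, with lists written
as tables `tab n f`.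
-/

/-! ### Runs of programs -/

namespace Prog

variable {α γ : Type} (y : ℕ → ℝ)

theorem run_pure (a : α) : (pure a : Prog α).run y = ⟨a, 0, []⟩ := rfl

/-- Costs and samples of consecutive programs add up. -/
theorem run_bind (p : Prog α) (f : α → Prog γ) :
    (p >>= f).run y =
      ⟨((f (p.run y).val).run y).val, (p.run y).steps + ((f (p.run y).val).run y).steps,
        (p.run y).samples ++ ((f (p.run y).val).run y).samples⟩ := by
  change (p.seq f).run y = _
  induction p with
  | ret a => simp [Prog.seq, Prog.run]
  | instr i next ih => simp [Prog.seq, Prog.run, ih, add_right_comm]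

theorem run_tick : tick.run y = ⟨(), 1, []⟩ := rfl
theorem run_sample (i : ℕ) : (sample i).run y = ⟨y i, 1, [i]⟩ := rfl
theorem run_radd (a b : ℝ) : (radd a b).run y = ⟨a + b, 1, []⟩ := rfl
theorem run_rsub (a b : ℝ) : (rsub a b).run y = ⟨a - b, 1, []⟩ := rfl
theorem run_rmul (a b : ℝ) : (rmul a b).run y = ⟨a * b, 1, []⟩ := rfl
theorem run_rdiv (a b : ℝ) : (rdiv a b).run y = ⟨a / b, 1, []⟩ := rfl
theorem run_rabs (a : ℝ) : (rabs a).run y = ⟨|a|, 1, []⟩ := rfl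
theorem run_rsqrt (a : ℝ) : (rsqrt a).run y = ⟨Real.sqrt a, 1, []⟩ := rfl
theorem run_cosPi (p q : ℕ) :
    (cosPi p q).run y = ⟨Real.cos ((p : ℝ) * Real.pi / (q : ℝ)), 1, []⟩ := rfl
theorem run_cast (a : ℕ) : (cast a).run y = ⟨(a : ℝ), 1, []⟩ := rfl
theorem run_rlt (a b : ℝ) : (rlt a b).run y = ⟨decide (a < b), 1, []⟩ := rfl
theorem run_nadd (a b : ℕ) : (nadd a b).run y = ⟨a + b, 1, []⟩ := rfl
theorem run_nsub (a b : ℕ) : (nsub a b).run y = ⟨a - b, 1, []⟩ := rfl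
theorem run_nmul (a b : ℕ) : (nmul a b).run y = ⟨a * b, 1, []⟩ := rfl
theorem run_shl (a b : ℕ) : (shl a b).run y = ⟨a * 2 ^ b, 1, []⟩ := rfl
theorem run_clog (a : ℕ) : (clog a).run y = ⟨Nat.clog 2 a, 1, []⟩ := rfl
theorem run_nlt (a b : ℕ) : (nlt a b).run y = ⟨decide (a < b), 1, []⟩ := rfl

attribute [local simp] run_pure run_bind run_tick run_sample run_radd run_rsub run_rmul run_rdiv
  run_rabs run_rsqrt run_cosPi run_cast run_rlt run_nadd run_nsub run_nmul run_shl run_clog run_nlt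

theorem run_cons (a : ℝ) (l : List ℝ) : (cons a l).run y = ⟨a :: l, 1, []⟩ := rfl

attribute [local simp] run_cons

theorem run_sqrtTwoPow (d : ℕ) : (sqrtTwoPow d).run y = ⟨Real.sqrt (2 ^ d), 3, []⟩ := by
  simp [sqrtTwoPow]

theorem run_map {f : ℝ → Prog ℝ} {g : ℝ → ℝ} {c : ℕ} (h : ∀ a, (f a).run y = ⟨g a, c, []⟩)
    (l : List ℝ) : (map f l).run y = ⟨l.map g, (c + 2) * l.length + 1, []⟩ := by
  induction l with
  | nil => simp [map]
  | cons a l ih => simp [map, ih, h]; ring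

theorem run_zipWith {f : ℝ → ℝ → Prog ℝ} {g : ℝ → ℝ → ℝ} {c : ℕ}
    (h : ∀ a b, (f a b).run y = ⟨g a b, c, []⟩) (l l' : List ℝ) :
    (zipWith f l l').run y =
      ⟨List.zipWith g l l', (c + 2) * min l.length l'.length + 1, []⟩ := by
  induction l generalizing l' with
  | nil => simp [zipWith]
  | cons a l ih =>
    cases l' with
    | nil => simp [zipWith]
    | cons b l' => simp [zipWith, ih, h, Nat.add_min_add_right]; ring

theorem run_rev (l acc : List ℝ) :
    (rev l acc).run y = ⟨l.reverse ++ acc, 2 * l.length + 1, []⟩ := by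
  induction l generalizing acc with
  | nil => simp [rev]
  | cons a l ih => simp [rev, ih]; ring

theorem run_append (l l' : List ℝ) : (append l l').run y = ⟨l ++ l', 2 * l.length + 1, []⟩ := by
  induction l with
  | nil => simp [append]
  | cons a l ih => simp [append, ih]; ring

theorem run_zeros (n : ℕ) : (zeros n).run y = ⟨List.replicate n 0, 2 * n + 1, []⟩ := by
  induction n with
  | zero => simp [zeros]
  | succ n ih => simp [zeros, ih, List.replicate_succ]; ring

theorem run_length (l : List ℝ) : (length l).run y = ⟨l.length, 2 * l.length + 1, []⟩ := by
  induction l with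
  | nil => simp [length]
  | cons a l ih => simp [length, ih]; ring

end Prog

/-! ### Tables of values -/

/-- The list `f 0, …, f (n - 1)`. Lists of known length are handled in this form. -/
def tab (n : ℕ) (f : ℕ → ℝ) : List ℝ := (List.range n).map f

@[simp] theorem tab_length (n : ℕ) (f : ℕ → ℝ) : (tab n f).length = n := by simp [tab]

theorem tab_zero (f : ℕ → ℝ) : tab 0 f = [] := rfl

theorem tab_succ (n : ℕ) (f : ℕ → ℝ) : tab (n + 1) f = f 0 :: tab n (fun i => f (i + 1)) := by
  simp [tab, List.range_succ_eq_map, Function.comp_def]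

theorem tab_congr {n : ℕ} {f g : ℕ → ℝ} (h : ∀ i < n, f i = g i) : tab n f = tab n g := by
  simp only [tab]
  exact List.map_congr_left fun i hi => h i (List.mem_range.1 hi)

theorem tab_getElem {n : ℕ} (f : ℕ → ℝ) (i : ℕ) (h : i < (tab n f).length) :
    (tab n f)[i] = f i := by simp [tab]

theorem tab_getD (n : ℕ) (f : ℕ → ℝ) (i : ℕ) : (tab n f).getD i 0 = if i < n then f i else 0 := by
  split_ifs with h
  · rw [List.getD_eq_getElem _ _ (by simpa using h), tab_getElem]
  · rw [List.getD_eq_default _ _ (by simpa using h)]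

theorem eq_tab (l : List ℝ) : l = tab l.length (fun i => l.getD i 0) := by
  apply List.ext_getElem (by simp)
  intro i h _
  rw [tab_getElem, List.getD_eq_getElem _ _ h]

theorem tab_map (g : ℝ → ℝ) (n : ℕ) (f : ℕ → ℝ) : (tab n f).map g = tab n (fun i => g (f i)) := by
  simp [tab, Function.comp_def]

theorem tab_zipWith (g : ℝ → ℝ → ℝ) (n : ℕ) (f f' : ℕ → ℝ) :
    List.zipWith g (tab n f) (tab n f') = tab n (fun i => g (f i) (f' i)) := by
  apply List.ext_getElem (by simp)
  intro i h _
  simp [tab_getElem]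

theorem tab_reverse (n : ℕ) (f : ℕ → ℝ) : (tab n f).reverse = tab n (fun i => f (n - 1 - i)) := by
  apply List.ext_getElem (by simp)
  intro i h _
  simp [tab_getElem]

theorem tab_append (n m : ℕ) (f g : ℕ → ℝ) :
    tab n f ++ tab m g = tab (n + m) (fun i => if i < n then f i else g (i - n)) := by
  apply List.ext_getElem (by simp)
  intro i h _
  rw [List.getElem_append, tab_getElem]
  simp [tab_getElem]

/-! ### Cosine transforms of types II, III and IV -/

open Finset in
/-- A telescoping sum. -/
theorem sum_cos_odd_mul (θ : ℝ) (n : ℕ) :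
    (∑ l ∈ range n, Real.cos ((2 * l + 1) * θ)) * (2 * Real.sin θ) = Real.sin (2 * n * θ) := by
  induction n with
  | zero => simp
  | succ n ih =>
    rw [sum_range_succ, add_mul, ih]
    have h1 : (2 * ((n + 1 : ℕ) : ℝ) * θ) = (2 * n + 1) * θ + θ := by push_cast; ring
    have h2 : (2 * (n : ℝ) * θ) = (2 * n + 1) * θ - θ := by ring
    rw [h1, h2, Real.sin_add, Real.sin_sub]; ring

open Finset in
theorem sum_cos_eq_zero {n : ℕ} {k : ℤ} (h0 : k ≠ 0) (h1 : -(2 * n) < k) (h2 : k < 2 * n) :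
    ∑ l ∈ range n, Real.cos (k * (2 * l + 1) * Real.pi / (2 * n)) = 0 := by
  have hn : (0 : ℝ) < n := by
    have : (0 : ℤ) < n := by omega
    exact_mod_cast this
  have hpi := Real.pi_pos
  have h1' : -(2 * (n : ℝ)) < k := by exact_mod_cast h1
  have h2' : (k : ℝ) < 2 * n := by exact_mod_cast h2
  have hs : Real.sin (k * Real.pi / (2 * n)) ≠ 0 := by
    rw [Ne, Real.sin_eq_zero_iff_of_lt_of_lt]
    · have : (k : ℝ) ≠ 0 := by exact_mod_cast h0
      positivity
    · rw [lt_div_iff₀ (by positivity)]; nlinarith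
    · rw [div_lt_iff₀ (by positivity)]; nlinarith
  have h := sum_cos_odd_mul (k * Real.pi / (2 * n)) n
  have e : 2 * (n : ℝ) * (k * Real.pi / (2 * n)) = k * Real.pi := by field_simp
  rw [e, Real.sin_int_mul_pi] at h
  have h' := (mul_eq_zero.1 h).resolve_right (by simpa using hs)
  rw [← h']
  refine sum_congr rfl fun l _ => ?_
  congr 1; ring

/-- The entry of the cosine matrix of type II with row `k` and column `l`. -/
noncomputable def kerII (n k l : ℕ) : ℝ :=
  Real.sqrt (2 / n) * (if k = 0 then 1 / Real.sqrt 2 else 1) *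
    Real.cos ((k : ℝ) * (2 * (l : ℝ) + 1) * Real.pi / (2 * (n : ℝ)))

/-- The transform of type II of length `n`, on functions of all indices. -/
noncomputable def c2 (n : ℕ) (x : ℕ → ℝ) (k : ℕ) : ℝ := ∑ l ∈ Finset.range n, kerII n k l * x l

/-- The transform of type III of length `n`, the transpose of `c2`. -/
noncomputable def c3 (n : ℕ) (x : ℕ → ℝ) (l : ℕ) : ℝ := ∑ k ∈ Finset.range n, kerII n k l * x k

/-- The transform of type IV of length `n`. -/
noncomputable def c4 (n : ℕ) (x : ℕ → ℝ) (k : ℕ) : ℝ :=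
  Real.sqrt (2 / n) * ∑ l ∈ Finset.range n,
    Real.cos ((2 * k + 1) * (2 * l + 1) * Real.pi / (4 * n)) * x l

theorem cos_mul_cos_eq (a b : ℝ) :
    Real.cos a * Real.cos b = (Real.cos (a + b) + Real.cos (a - b)) / 2 := by
  rw [Real.cos_add, Real.cos_sub]; ring

open Finset in
theorem sum_kerII_mul_kerII {n k k' : ℕ} (hk : k < n) (hk' : k' < n) :
    ∑ l ∈ range n, kerII n k l * kerII n k' l = if k = k' then 1 else 0 := by
  have hn : (0 : ℝ) < n := by exact_mod_cast (by omega : 0 < n)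
  have h2 : Real.sqrt 2 * Real.sqrt 2 = 2 := Real.mul_self_sqrt (by norm_num)
  have hs : Real.sqrt (2 / n) * Real.sqrt (2 / n) = 2 / n := Real.mul_self_sqrt (by positivity)
  have key : ∑ l ∈ range n, kerII n k l * kerII n k' l =
      (2 / n) * ((if k = 0 then 1 / Real.sqrt 2 else 1) * (if k' = 0 then 1 / Real.sqrt 2 else 1)) *
      ((∑ l ∈ range n, Real.cos (((k + k' : ℕ) : ℤ) * (2 * l + 1) * Real.pi / (2 * n)) +
        ∑ l ∈ range n, Real.cos (((k - k' : ℤ)) * (2 * l + 1) * Real.pi / (2 * n))) / 2) := by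
    rw [← sum_add_distrib, sum_div, mul_sum]
    refine sum_congr rfl fun l _ => ?_
    have := cos_mul_cos_eq ((k : ℝ) * (2 * (l : ℝ) + 1) * Real.pi / (2 * (n : ℝ)))
      ((k' : ℝ) * (2 * (l : ℝ) + 1) * Real.pi / (2 * (n : ℝ)))
    rw [show (((k + k' : ℕ) : ℤ) : ℝ) * (2 * l + 1) * Real.pi / (2 * n) =
        (k : ℝ) * (2 * (l : ℝ) + 1) * Real.pi / (2 * (n : ℝ)) +
        (k' : ℝ) * (2 * (l : ℝ) + 1) * Real.pi / (2 * (n : ℝ)) by push_cast; ring,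
      show ((k - k' : ℤ) : ℝ) * (2 * l + 1) * Real.pi / (2 * n) =
        (k : ℝ) * (2 * (l : ℝ) + 1) * Real.pi / (2 * (n : ℝ)) -
        (k' : ℝ) * (2 * (l : ℝ) + 1) * Real.pi / (2 * (n : ℝ)) by push_cast; ring, ← this, ← hs]
    simp only [kerII]; ring
  rw [key]
  by_cases h : k = k'
  · subst h
    by_cases h0 : k = 0
    · subst h0
      simp
      field_simp
      linarith
    · rw [sum_cos_eq_zero (by omega) (by omega) (by omega)]
      have := hn.ne'
      simp [h0, this]
  · rw [sum_cos_eq_zero (by omega) (by omega) (by omega),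
      sum_cos_eq_zero (by omega) (by omega) (by omega)]
    simp [h]

/-- The cosine matrix of type II is orthogonal. -/
theorem c3_c2 {n : ℕ} (x : ℕ → ℝ) {i : ℕ} (hi : i < n) : c3 n (c2 n x) i = x i := by
  let A : Matrix (Fin n) (Fin n) ℝ := Matrix.of fun k l => kerII n k l
  have h1 : A * A.transpose = 1 := by
    ext k k'
    rw [Matrix.mul_apply, Matrix.one_apply]
    simp only [A, Matrix.transpose_apply, Matrix.of_apply]
    rw [Fin.sum_univ_eq_sum_range (fun l => kerII n k l * kerII n k' l),
      sum_kerII_mul_kerII k.2 k'.2]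
    simp [Fin.ext_iff]
  have h2 : A.transpose * A = 1 := mul_eq_one_comm.1 h1
  have h3 : A.transpose.mulVec (A.mulVec fun l : Fin n => x l) = fun l : Fin n => x l := by
    rw [Matrix.mulVec_mulVec, h2, Matrix.one_mulVec]
  have h4 := congrFun h3 ⟨i, hi⟩
  simp only [Matrix.mulVec, dotProduct, A, Matrix.transpose_apply, Matrix.of_apply] at h4
  rw [← h4, c3, ← Fin.sum_univ_eq_sum_range (fun k => kerII n k i * c2 n x k)]
  refine Finset.sum_congr rfl fun k _ => ?_
  congr 1
  rw [c2, ← Fin.sum_univ_eq_sum_range (fun l => kerII n k l * x l)]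

open Finset in
/-- The cosine matrix of type IV is symmetric and orthogonal. -/
theorem c4_c4 {n : ℕ} (x : ℕ → ℝ) {i : ℕ} (hi : i < n) : c4 n (c4 n x) i = x i := by
  have hn : (0 : ℝ) < n := by exact_mod_cast (by omega : 0 < n)
  have hs : Real.sqrt (2 / n) * Real.sqrt (2 / n) = 2 / n := Real.mul_self_sqrt (by positivity)
  have orth : ∀ l ∈ range n, ∑ k ∈ range n,
      Real.cos ((2 * i + 1) * (2 * k + 1) * Real.pi / (4 * n)) *
        Real.cos ((2 * k + 1) * (2 * l + 1) * Real.pi / (4 * n)) =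
      if i = l then (n : ℝ) / 2 else 0 := by
    intro l hl
    have hl := mem_range.1 hl
    have key : ∑ k ∈ range n, Real.cos ((2 * i + 1) * (2 * k + 1) * Real.pi / (4 * n)) *
      Real.cos ((2 * k + 1) * (2 * l + 1) * Real.pi / (4 * n)) =
      (∑ k ∈ range n, Real.cos (((i + l + 1 : ℕ) : ℤ) * (2 * k + 1) * Real.pi / (2 * n)) +
        ∑ k ∈ range n, Real.cos (((i - l : ℤ)) * (2 * k + 1) * Real.pi / (2 * n))) / 2 := by
      rw [← sum_add_distrib, sum_div]
      refine sum_congr rfl fun k _ => ?_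
      rw [cos_mul_cos_eq]
      congr 3 <;> · push_cast; field_simp; ring
    rw [key, sum_cos_eq_zero (by omega) (by omega) (by omega)]
    split_ifs with h
    · subst h; simp
    · rw [sum_cos_eq_zero (by omega) (by omega) (by omega)]; simp
  calc c4 n (c4 n x) i = (2 / n) * ∑ k ∈ range n, ∑ l ∈ range n,
        (Real.cos ((2 * i + 1) * (2 * k + 1) * Real.pi / (4 * n)) *
          Real.cos ((2 * k + 1) * (2 * l + 1) * Real.pi / (4 * n))) * x l := by
        simp only [c4]
        conv_rhs => rw [← hs, mul_assoc]
        congr 1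
        rw [mul_sum]
        refine sum_congr rfl fun k _ => ?_
        rw [mul_left_comm]
        congr 1
        rw [mul_sum]
        refine sum_congr rfl fun l _ => ?_
        ring
    _ = (2 / n) * ∑ l ∈ range n, (if i = l then (n : ℝ) / 2 else 0) * x l := by
        rw [sum_comm]
        congr 1
        refine sum_congr rfl fun l hl => ?_
        rw [← sum_mul, orth l hl]
    _ = x i := by
        simp only [ite_mul, zero_mul, sum_ite_eq, mem_range, hi, if_true]
        field_simp

open Finset in
theorem sum_range_double_eq_fold (n : ℕ) (F : ℕ → ℝ) :
    ∑ l ∈ range (2 * n), F l = ∑ l ∈ range n, (F l + F (2 * n - 1 - l)) := by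
  rw [two_mul, sum_range_add, sum_add_distrib, ← sum_range_reflect (fun l => F (n + l))]
  congr 1
  refine sum_congr rfl fun l hl => ?_
  have := mem_range.1 hl
  congr 1; omega

open Finset in
theorem sum_range_double_eq_even_add_odd (n : ℕ) (F : ℕ → ℝ) :
    ∑ l ∈ range (2 * n), F l = ∑ l ∈ range n, F (2 * l) + ∑ l ∈ range n, F (2 * l + 1) := by
  induction n with
  | zero => simp
  | succ n ih =>
    rw [mul_add, mul_one, sum_range_succ, sum_range_succ, ih, sum_range_succ, sum_range_succ]; ring

theorem sqrt_two_div_two_mul (n : ℕ) :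
    Real.sqrt (2 / (2 * n : ℕ)) = Real.sqrt (2 / n) / Real.sqrt 2 := by
  rw [← Real.sqrt_div (by positivity)]
  congr 1; push_cast; rw [div_div, mul_comm (n : ℝ)]

theorem kerII_two_mul (n k l : ℕ) : kerII (2 * n) (2 * k) l = kerII n k l / Real.sqrt 2 := by
  rw [kerII, kerII, sqrt_two_div_two_mul]
  rcases Nat.eq_zero_or_pos n with h | h
  · subst h; simp
  · have : (0 : ℝ) < n := by exact_mod_cast h
    have e : ((2 * k : ℕ) : ℝ) * (2 * (l : ℝ) + 1) * Real.pi / (2 * ((2 * n : ℕ) : ℝ)) =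
      (k : ℝ) * (2 * (l : ℝ) + 1) * Real.pi / (2 * (n : ℝ)) := by
        push_cast; field_simp
    rw [e]; simp only [mul_eq_zero, OfNat.ofNat_ne_zero, false_or]; ring

theorem kerII_two_mul_add_one (n k l : ℕ) : kerII (2 * n) (2 * k + 1) l =
    Real.sqrt (2 / n) / Real.sqrt 2 *
      Real.cos ((2 * k + 1) * (2 * l + 1) * Real.pi / (4 * n)) := by
  rw [kerII, sqrt_two_div_two_mul]
  have e : ((2 * k + 1 : ℕ) : ℝ) * (2 * (l : ℝ) + 1) * Real.pi / (2 * ((2 * n : ℕ) : ℝ)) =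
      (2 * k + 1) * (2 * l + 1) * Real.pi / (4 * n) := by
        push_cast; ring
  rw [e]; simp

theorem kerII_even_reflect {n l : ℕ} (k : ℕ) (hn : 0 < n) (hl : l < 2 * n) :
    kerII (2 * n) (2 * k) (2 * n - 1 - l) = kerII (2 * n) (2 * k) l := by
  have hn' : (0 : ℝ) < n := by exact_mod_cast hn
  rw [kerII, kerII]
  congr 1
  have e : ((2 * n - 1 - l : ℕ) : ℝ) = 2 * n - 1 - l := by
    rw [Nat.cast_sub (by omega), Nat.cast_sub (by omega)]; push_cast; ring
  have : ((2 * k : ℕ) : ℝ) * (2 * ((2 * n - 1 - l : ℕ) : ℝ) + 1) * Real.pi / (2 * (2 * n : ℕ)) =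
      k * (2 * Real.pi) - ((2 * k : ℕ) : ℝ) * (2 * (l : ℝ) + 1) * Real.pi / (2 * (2 * n : ℕ)) := by
    rw [e]; push_cast; field_simp; ring
  rw [this, Real.cos_nat_mul_two_pi_sub]

theorem kerII_odd_reflect {n l : ℕ} (k : ℕ) (hn : 0 < n) (hl : l < 2 * n) :
    kerII (2 * n) (2 * k + 1) (2 * n - 1 - l) = - kerII (2 * n) (2 * k + 1) l := by
  have hn' : (0 : ℝ) < n := by exact_mod_cast hn
  rw [kerII, kerII, ← mul_neg]
  congr 1
  have e : ((2 * n - 1 - l : ℕ) : ℝ) = 2 * n - 1 - l := by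
    rw [Nat.cast_sub (by omega), Nat.cast_sub (by omega)]; push_cast; ring
  have : ((2 * k + 1 : ℕ) : ℝ) * (2 * ((2 * n - 1 - l : ℕ) : ℝ) + 1) * Real.pi / (2 * (2 * n : ℕ)) =
      (k * (2 * Real.pi) -
        ((2 * k + 1 : ℕ) : ℝ) * (2 * (l : ℝ) + 1) * Real.pi / (2 * (2 * n : ℕ))) + Real.pi := by
    rw [e]; push_cast; field_simp; ring
  rw [this, Real.cos_add_pi, Real.cos_nat_mul_two_pi_sub]

open Finset in
/-- The coefficients with even index only depend on the reflected periodization. -/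
theorem c2_two_mul (n : ℕ) (g : ℕ → ℝ) (k : ℕ) :
    c2 n (fun l => g l + g (2 * n - 1 - l)) k = Real.sqrt 2 * c2 (2 * n) g (2 * k) := by
  rw [c2, c2, sum_range_double_eq_fold, mul_sum]
  refine sum_congr rfl fun l hl => ?_
  have hl := mem_range.1 hl
  rw [kerII_even_reflect k (by omega) (by omega), kerII_two_mul]
  have : Real.sqrt 2 ≠ 0 := by positivity
  field_simp

open Finset in
/-- The coefficients with odd index only depend on the difference of the first half and the
reflected second half. -/
theorem c2_two_mul_add_one (n : ℕ) (g : ℕ → ℝ) (k : ℕ) :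
    c2 (2 * n) g (2 * k + 1) = Real.sqrt (2 / n) / Real.sqrt 2 * ∑ l ∈ range n,
      Real.cos ((2 * k + 1) * (2 * l + 1) * Real.pi / (4 * n)) * (g l - g (2 * n - 1 - l)) := by
  rw [c2, sum_range_double_eq_fold, mul_sum]
  refine sum_congr rfl fun l hl => ?_
  have hl := mem_range.1 hl
  rw [kerII_odd_reflect k (by omega) (by omega), kerII_two_mul_add_one]
  ring

open Finset in
theorem c3_two_mul (n : ℕ) (y : ℕ → ℝ) (l : ℕ) :
    c3 (2 * n) y l = (c3 n (fun k => y (2 * k)) l + c4 n (fun k => y (2 * k + 1)) l) /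
      Real.sqrt 2 := by
  rw [c3, sum_range_double_eq_even_add_odd, add_div, c3, c4, sum_div, mul_sum, sum_div]
  congr 1
  · refine sum_congr rfl fun k _ => ?_
    rw [kerII_two_mul]; ring
  · refine sum_congr rfl fun k _ => ?_
    rw [kerII_two_mul_add_one, mul_comm (2 * (l : ℝ) + 1)]; ring

open Finset in
theorem c3_two_mul_reflect {n l : ℕ} (y : ℕ → ℝ) (hl : l < n) :
    c3 (2 * n) y (2 * n - 1 - l) = (c3 n (fun k => y (2 * k)) l - c4 n (fun k => y (2 * k + 1)) l) /
      Real.sqrt 2 := by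
  rw [c3, sum_range_double_eq_even_add_odd, sub_div, sub_eq_add_neg, c3, c4, sum_div, mul_sum,
    sum_div, ← sum_neg_distrib]
  congr 1
  · refine sum_congr rfl fun k _ => ?_
    rw [kerII_even_reflect k (by omega) (by omega), kerII_two_mul]; ring
  · refine sum_congr rfl fun k _ => ?_
    rw [kerII_odd_reflect k (by omega) (by omega), kerII_two_mul_add_one,
      mul_comm (2 * (l : ℝ) + 1)]; ring

open Finset in
/-- The transform of type IV in terms of the one of type III of the same length. -/
theorem c4_eq_c3 {n k : ℕ} (b : ℕ → ℝ) (hk : k < n) :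
    c4 n b k = c3 n (fun l => if l = 0 then Real.sqrt 2 * b 0 else b (l - 1) + b l) k /
      (2 * Real.cos ((2 * k + 1) * Real.pi / (4 * n))) := by
  have hn : (0 : ℝ) < n := by exact_mod_cast (by omega : 0 < n)
  have hk' : (k : ℝ) + 1 ≤ n := by exact_mod_cast hk
  have hpi := Real.pi_pos
  have hc : 0 < Real.cos ((2 * k + 1) * Real.pi / (4 * n)) := by
    apply Real.cos_pos_of_mem_Ioo
    constructor
    · have : 0 < (2 * (k : ℝ) + 1) * Real.pi / (4 * n) := by positivity
      linarith
    · rw [div_lt_iff₀ (by positivity)]; nlinarith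
  rw [eq_div_iff (by positivity)]
  obtain ⟨N, rfl⟩ : ∃ N, n = N + 1 := ⟨n - 1, by omega⟩
  set C : ℕ → ℝ := fun l => Real.cos (l * (2 * k + 1) * Real.pi / (2 * (N + 1 : ℕ))) with hC
  have hC0 : C 0 = 1 := by simp [hC]
  have hCn : C (N + 1) = 0 := by
    simp only [hC]
    rw [show ((N + 1 : ℕ) : ℝ) * (2 * k + 1) * Real.pi / (2 * (N + 1 : ℕ)) =
      k * Real.pi + Real.pi / 2 by field_simp, Real.cos_add_pi_div_two,
      Real.sin_nat_mul_pi, neg_zero]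
  have hmul : ∀ l : ℕ, Real.cos ((2 * k + 1) * (2 * l + 1) * Real.pi / (4 * (N + 1 : ℕ))) *
      (2 * Real.cos ((2 * k + 1) * Real.pi / (4 * (N + 1 : ℕ)))) = C (l + 1) + C l := by
    intro l
    rw [mul_left_comm, cos_mul_cos_eq, mul_div_cancel₀ _ two_ne_zero]
    simp only [hC]
    congr 2 <;> · push_cast; field_simp; ring
  have hsum : ∀ m, ∑ l ∈ range (m + 1), (C (l + 1) + C l) * b l =
      C 0 * b 0 + ∑ l ∈ range m, C (l + 1) * (b l + b (l + 1)) + C (m + 1) * b m := by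
    intro m
    induction m with
    | zero => simp; ring
    | succ m ih =>
      rw [sum_range_succ, ih, sum_range_succ (fun l => C (l + 1) * (b l + b (l + 1)))]; ring
  have hs2 : Real.sqrt 2 ≠ 0 := by positivity
  calc c4 (N + 1) b k * (2 * Real.cos ((2 * k + 1) * Real.pi / (4 * (N + 1 : ℕ))))
      = Real.sqrt (2 / (N + 1 : ℕ)) * ∑ l ∈ range (N + 1), (C (l + 1) + C l) * b l := by
        rw [c4, mul_assoc, sum_mul]
        congr 1
        refine sum_congr rfl fun l _ => ?_
        rw [← hmul l]; ring
    _ = _ := by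
        rw [hsum, hCn, c3, sum_range_succ', mul_add, mul_add, mul_sum, hC0]
        simp only [zero_mul, mul_zero, add_zero, Nat.add_sub_cancel, Nat.add_eq_zero_iff, one_ne_zero,
          and_false, if_false, if_true]
        rw [add_comm]
        congr 1
        · refine sum_congr rfl fun l _ => ?_
          rw [kerII, if_neg (by omega)]
          simp only [hC]; ring
        · simp [kerII]; field_simp

namespace Prog
/-! ### Correctness and costs of the fast transforms -/

attribute [local simp] run_pure run_bind run_tick run_sample run_radd run_rsub run_rmul run_rdiv
  run_rabs run_rsqrt run_cosPi run_cast run_rlt run_nadd run_nsub run_nmul run_shl run_clog run_nlt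
  run_cons run_sqrtTwoPow

theorem run_evenOdd_tab (y : ℕ → ℝ) (n : ℕ) (f : ℕ → ℝ) :
    (evenOdd (tab n f)).run y =
      ⟨(tab ((n + 1) / 2) fun i => f (2 * i), tab (n / 2) fun i => f (2 * i + 1)),
        2 * n + 1, []⟩ := by
  induction n generalizing f with
  | zero => simp [evenOdd, tab_zero]
  | succ n ih =>
    rw [tab_succ, evenOdd]
    simp [ih]
    rw [show (n + 1 + 1) / 2 = n / 2 + 1 by omega, tab_succ]
    exact ⟨rfl, by ring⟩

theorem run_pairSums_tab (y : ℕ → ℝ) (n : ℕ) (p : ℝ) (f : ℕ → ℝ) :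
    (pairSums p (tab n f)).run y =
      ⟨tab n fun i => (if i = 0 then p else f (i - 1)) + f i, 3 * n + 1, []⟩ := by
  induction n generalizing f p with
  | zero => simp [pairSums, tab_zero]
  | succ n ih =>
    rw [tab_succ, pairSums]
    simp [ih]
    refine ⟨?_, by ring⟩
    rw [tab_succ]
    simp only [if_true, List.cons.injEq, true_and, Nat.add_eq_zero_iff, one_ne_zero, and_false,
      if_false, Nat.add_sub_cancel]
    refine tab_congr fun i _ => ?_
    cases i <;> simp

theorem run_prepareIV_tab (y : ℕ → ℝ) (n : ℕ) (f : ℕ → ℝ) :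
    (prepareIV (tab (n + 1) f)).run y =
      ⟨tab (n + 1) fun l => if l = 0 then Real.sqrt 2 * f 0 else f (l - 1) + f l,
        3 * n + 7, []⟩ := by
  rw [tab_succ, prepareIV]
  simp [run_pairSums_tab]
  refine ⟨?_, by ring⟩
  rw [tab_succ]
  simp only [if_true, List.cons.injEq, true_and, Nat.add_eq_zero_iff, one_ne_zero, and_false,
    if_false, Nat.add_sub_cancel]
  refine tab_congr fun i _ => ?_
  cases i <;> simp

theorem run_divTwoCos_tab (y : ℕ → ℝ) (q n p : ℕ) (f : ℕ → ℝ) :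
    (divTwoCos q p (tab n f)).run y =
      ⟨tab n fun i => f i / (2 * Real.cos ((p + 2 * i) * Real.pi / q)), 6 * n + 1, []⟩ := by
  induction n generalizing f p with
  | zero => simp [divTwoCos, tab_zero]
  | succ n ih =>
    rw [tab_succ, divTwoCos]
    simp [ih]
    refine ⟨?_, by ring⟩
    rw [tab_succ, two_mul]
    simp only [List.cons.injEq]
    refine ⟨by simp, tab_congr fun i _ => ?_⟩
    congr 4; push_cast; ring

theorem run_dctIVUsing_tab (y : ℕ → ℝ) (f : List ℝ → Prog (List ℝ)) (e T : ℕ)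
    (h : ∀ g, (f (tab (2 ^ e) g)).run y = ⟨tab (2 ^ e) (c3 (2 ^ e) g), T, []⟩) (g : ℕ → ℝ) :
    (dctIVUsing f e (tab (2 ^ e) g)).run y =
      ⟨tab (2 ^ e) (c4 (2 ^ e) g), T + 9 * 2 ^ e + 7, []⟩ := by
  have hp := run_prepareIV_tab y (2 ^ e - 1) g
  rw [Nat.sub_add_cancel Nat.one_le_two_pow] at hp
  simp [dctIVUsing, hp, h, run_divTwoCos_tab]
  constructor
  · refine tab_congr fun i hi => ?_
    rw [c4_eq_c3 g hi]
    congr 4 <;> · push_cast; ring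
  · have := Nat.one_le_two_pow (n := e)
    omega

/-- The fast transform of type III computes `c3`, at a cost that is the same for all lists of the
same length. The bound solves the recursion `T (e + 1) = 2 T(e) + O(2 ^ e)`. -/
theorem run_dctIII_tab (y : ℕ → ℝ) (e : ℕ) :
    ∃ T ≤ (41 * e + 1) * 2 ^ e, ∀ g, (dctIII e (tab (2 ^ e) g)).run y =
      ⟨tab (2 ^ e) (c3 (2 ^ e) g), T, []⟩ := by
  induction e with
  | zero =>
    refine ⟨1, by simp, fun g => ?_⟩
    simp only [dctIII, run_bind, run_tick, run_pure, pow_zero, List.append_nil]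
    congr 1
    refine tab_congr fun i hi => ?_
    obtain rfl : i = 0 := by omega
    have : Real.sqrt 2 ≠ 0 := by positivity
    simp [c3, kerII, this]
  | succ e ih =>
    obtain ⟨T, hT, h⟩ := ih
    refine ⟨2 * T + 25 * 2 ^ e + 16, ?_, fun g => ?_⟩
    · have := Nat.one_le_two_pow (n := e)
      rw [pow_succ]
      nlinarith
    · have h4 := run_dctIVUsing_tab y (dctIII e) e T h
      have e1 : (2 ^ (e + 1) + 1) / 2 = 2 ^ e := by rw [pow_succ]; omega
      have e2 : 2 ^ (e + 1) / 2 = 2 ^ e := by rw [pow_succ]; omega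
      rw [dctIII]
      simp only [run_bind, run_tick, run_evenOdd_tab, e1, e2, h, h4, run_sqrtTwoPow, pow_one]
      rw [run_zipWith (g := fun u v => (u + v) / Real.sqrt 2) (c := 2) y (by intros; simp),
        run_zipWith (g := fun u v => (u - v) / Real.sqrt 2) (c := 2) y (by intros; simp)]
      simp only [run_rev, run_append, tab_zipWith, List.append_nil, tab_reverse, tab_append,
        tab_length, min_self]
      congr 1
      · rw [← two_mul, ← pow_succ']
        refine tab_congr fun i hi => ?_
        rw [pow_succ'] at hi ⊢
        split_ifs with hi'
        · rw [c3_two_mul]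
        · have := c3_two_mul_reflect (n := 2 ^ e) (l := 2 ^ e - 1 - (i - 2 ^ e)) g (by omega)
          rw [← this]
          congr 1; omega
      · rw [pow_succ]; ring

theorem run_dctIV_tab (y : ℕ → ℝ) (e : ℕ) :
    ∃ T ≤ (41 * e + 17) * 2 ^ e, ∀ g, (dctIV e (tab (2 ^ e) g)).run y =
      ⟨tab (2 ^ e) (c4 (2 ^ e) g), T, []⟩ := by
  obtain ⟨T, hT, h⟩ := run_dctIII_tab y e
  refine ⟨_, ?_, run_dctIVUsing_tab y (dctIII e) e T h⟩
  have := Nat.one_le_two_pow (n := e)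
  nlinarith

end Prog

namespace SparseDCT
open Prog

attribute [local simp] run_pure run_bind run_tick run_sample run_radd run_rsub run_rmul run_rdiv
  run_rabs run_rsqrt run_cosPi run_cast run_rlt run_nadd run_nsub run_nmul run_shl run_clog run_nlt
  run_cons run_sqrtTwoPow

/-! ### The auxiliary procedures of the sparse transform -/

theorem run_samples (y : ℕ → ℝ) (s : ℝ) (stride n start : ℕ) :
    (samples s stride n start).run y =
      ⟨tab n fun i => s * y (start + stride * i), 5 * n + 1,
        (List.range n).map fun i => start + stride * i⟩ := by
  induction n generalizing start with
  | zero => simp [samples, tab_zero]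
  | succ n ih =>
    rw [samples]
    simp [ih]
    refine ⟨?_, by ring, ?_⟩
    · rw [tab_succ]
      simp only [mul_zero, add_zero, List.cons.injEq, true_and]
      refine tab_congr fun i _ => ?_
      rw [mul_add, mul_one, add_assoc, add_comm stride]
    · rw [List.range_succ_eq_map]
      simp
      intro i _; ring

/-- The list is split into an initial part `t` of small entries and a remainder `r`. -/
theorem run_dropSmall (y : ℕ → ℝ) (ε : ℝ) (l : List ℝ) (i : ℕ) :
    ∃ t r s, l = t ++ r ∧ (∀ a ∈ t, |a| ≤ ε) ∧ (∀ a ∈ r.head?, ε < |a|) ∧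
      s ≤ 4 * l.length + 1 ∧ (dropSmall ε i l).run y = ⟨(i + t.length, r), s, []⟩ := by
  induction l generalizing i with
  | nil => exact ⟨[], [], 1, by simp [dropSmall]⟩
  | cons a l ih =>
    by_cases h : ε < |a|
    · refine ⟨[], a :: l, 3, by simp, by simp, by simpa using h, ?_, ?_⟩
      · simp only [List.length_cons]; omega
      · simp [dropSmall, h]
    · obtain ⟨t, r, s, h1, h2, h3, h4, h5⟩ := ih (i + 1)
      refine ⟨a :: t, r, s + 4, by simp [h1], ?_, h3, by simp; omega, ?_⟩
      · intro b hb
        rcases List.mem_cons.1 hb with rfl | hb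
        · exact not_lt.1 h
        · exact h2 b hb
      · simp [dropSmall, h, h5]
        exact ⟨by ring, by ring⟩

theorem run_cosSum_tab (y : ℕ → ℝ) (κ q t n : ℕ) (f : ℕ → ℝ) :
    (cosSum κ q t (tab n f)).run y =
      ⟨∑ l ∈ Finset.range n, Real.cos (κ * (t + 2 * l) * Real.pi / q) * f l, 6 * n + 1, []⟩ := by
  induction n generalizing t f with
  | zero => simp [cosSum, tab_zero]
  | succ n ih =>
    rw [tab_succ, cosSum]
    simp [ih]
    refine ⟨?_, by ring⟩
    rw [Finset.sum_range_succ', add_comm]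
    congr 1
    · refine Finset.sum_congr rfl fun l _ => ?_
      congr 4; push_cast; ring
    · simp

theorem run_signedSec_tab (y : ℕ → ℝ) (q : ℕ) (s : ℝ) (p n : ℕ) (f : ℕ → ℝ) :
    (signedSec q s p (tab n f)).run y =
      ⟨tab n fun i => (-1) ^ i * s * (f i / Real.cos ((p + 2 * i) * Real.pi / q)), 7 * n + 1,
        []⟩ := by
  induction n generalizing s p f with
  | zero => simp [signedSec, tab_zero]
  | succ n ih =>
    rw [tab_succ, signedSec]
    simp [ih]
    refine ⟨?_, by ring⟩
    rw [tab_succ]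
    simp only [List.cons.injEq]
    refine ⟨by simp, tab_congr fun i _ => ?_⟩
    rw [pow_succ, show ((p : ℝ) + 2 + 2 * i) = p + 2 * (i + 1 : ℕ) by push_cast; ring]
    ring

/-- The result of the search for the entry of largest modulus: it is at least as large as all
entries of the list, and unless it is the initial one, it is an entry with its proper label. -/
theorem run_argmaxAbs_tab (y : ℕ → ℝ) (k bk : ℕ) (b : ℝ) (n : ℕ) (f : ℕ → ℝ) :
    ∃ bk' b' s, (argmaxAbs k bk b (tab n f)).run y = ⟨(bk', b'), s, []⟩ ∧ s ≤ 5 * n + 1 ∧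
      |b| ≤ |b'| ∧ (∀ i < n, |f i| ≤ |b'|) ∧
      ((bk' = bk ∧ b' = b) ∨ ∃ i < n, bk' = k + 2 * i ∧ b' = f i) := by
  induction n generalizing k bk b f with
  | zero => exact ⟨bk, b, 1, by simp [argmaxAbs, tab_zero]⟩
  | succ n ih =>
    rw [tab_succ, argmaxAbs]
    by_cases h : |b| < |f 0|
    · obtain ⟨bk', b', s, h1, h2, h3, h4, h5⟩ := ih (k + 2) k (f 0) (fun i => f (i + 1))
      refine ⟨bk', b', s + 5, by simp [h, h1]; ring, by omega, h.le.trans h3, ?_, ?_⟩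
      · intro i hi
        cases i with
        | zero => exact h3
        | succ i => exact h4 i (by omega)
      · right
        rcases h5 with ⟨h5, h6⟩ | ⟨i, hi, h5, h6⟩
        · exact ⟨0, by omega, by omega, h6⟩
        · exact ⟨i + 1, by omega, by omega, h6⟩
    · obtain ⟨bk', b', s, h1, h2, h3, h4, h5⟩ := ih (k + 2) bk b (fun i => f (i + 1))
      refine ⟨bk', b', s + 5, by simp [h, h1]; ring, by omega, h3, ?_, ?_⟩
      · intro i hi
        cases i with
        | zero => exact (not_lt.1 h).trans h3
        | succ i => exact h4 i (by omega)
      · rcases h5 with h5 | ⟨i, hi, h5, h6⟩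
        · exact Or.inl h5
        · exact Or.inr ⟨i + 1, by omega, by omega, h6⟩

end SparseDCT

/-- The block `B` stores the vector `f`: the support interval of `f` is not empty, it starts and
ends as recorded in `B`, and its entries are listed in `B`. -/
structure Block.Represents (B : Block) (f : ℕ → ℝ) : Prop where
  vals_length : B.vals.length = B.len
  len_pos : 0 < B.len
  apply : ∀ k, f k = if B.first ≤ k then B.vals.getD (k - B.first) 0 else 0
  first_ne : f B.first ≠ 0
  last_ne : f (B.first + B.len - 1) ≠ 0

namespace Block.Represents

variable {B : Block} {f : ℕ → ℝ}

theorem eq_zero_of_lt (h : B.Represents f) {k : ℕ} (hk : k < B.first) : f k = 0 := by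
  rw [h.apply, if_neg (by omega)]

theorem eq_zero_of_ge (h : B.Represents f) {k : ℕ} (hk : B.first + B.len ≤ k) : f k = 0 := by
  rw [h.apply, if_pos (by omega), List.getD_eq_default]
  have := h.vals_length
  omega

theorem vals_eq (h : B.Represents f) : B.vals = tab B.len fun i => f (B.first + i) := by
  conv_lhs => rw [eq_tab B.vals, h.vals_length]
  refine tab_congr fun i _ => ?_
  rw [h.apply, if_pos (by omega), Nat.add_sub_cancel_left]

theorem of_tab {f : ℕ → ℝ} {a n : ℕ} (hn : 0 < n) (h1 : ∀ k < a, f k = 0)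
    (h2 : ∀ k, a + n ≤ k → f k = 0) (h3 : f a ≠ 0) (h4 : f (a + n - 1) ≠ 0) :
    (Block.mk a n (tab n fun i => f (a + i))).Represents f := by
  refine ⟨by simp, hn, fun k => ?_, h3, h4⟩
  dsimp only
  rw [tab_getD]
  split_ifs with h h'
  · congr 1; omega
  · exact h2 k (by omega)
  · exact h1 k (by omega)

end Block.Represents

namespace SparseDCT
open Prog

attribute [local simp] run_pure run_bind

/-- If the threshold separates the nonzero entries from zero, the search finds the exact support.
-/
theorem run_findSupport (y : ℕ → ℝ) {ε : ℝ} (base n : ℕ) {f : ℕ → ℝ} (hε : 0 ≤ ε)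
    (h0 : ∀ k < base, f k = 0) (h1 : ∀ k, base + n ≤ k → f k = 0)
    (hf : ∀ k, f k ≠ 0 → ε < |f k|) (hne : ∃ k, f k ≠ 0) :
    ∃ B s, (findSupport ε base (tab n fun i => f (base + i))).run y = ⟨B, s, []⟩ ∧
      s ≤ 14 * n + 5 ∧ B.Represents f := by
  obtain ⟨t, r, s, e1, e2, e3, e4, e5⟩ := run_dropSmall y ε (tab n fun i => f (base + i)) base
  obtain ⟨t', r', s', e1', e2', e3', e4', e5'⟩ := run_dropSmall y ε r.reverse 0
  have hr : r = r'.reverse ++ t'.reverse := by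
    rw [← List.reverse_append, ← e1', List.reverse_reverse]
  have hlen : n = t.length + (r'.length + t'.length) := by
    have := congrArg List.length e1
    rw [hr] at this
    simpa using this
  have small : ∀ k, |f k| ≤ ε → f k = 0 := fun k hk => by
    by_contra h; exact absurd (hf k h) (not_lt.2 hk)
  have get : ∀ i < n, f (base + i) = (t ++ (r'.reverse ++ t'.reverse)).getD i 0 := fun i hi => by
    rw [← hr, ← e1, tab_getD, if_pos hi]
  have z1 : ∀ k < base + t.length, f k = 0 := fun k hk => by
    rcases lt_or_ge k base with h | h
    · exact h0 k h
    · obtain ⟨i, rfl⟩ := Nat.exists_eq_add_of_le h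
      apply small
      rw [get i (by omega), List.getD_append _ _ _ _ (by omega),
        List.getD_eq_getElem _ _ (by omega)]
      exact e2 _ (List.getElem_mem _)
  have z2 : ∀ k, base + t.length + r'.length ≤ k → f k = 0 := fun k hk => by
    rcases le_or_gt (base + n) k with h | h
    · exact h1 k h
    · obtain ⟨i, rfl⟩ := Nat.exists_eq_add_of_le (show base ≤ k by omega)
      apply small
      rw [get i (by omega), List.getD_append_right _ _ _ _ (by omega),
        List.getD_append_right _ _ _ _ (by simp; omega),
        List.getD_eq_getElem _ _ (by simp; omega)]
      exact e2' _ (List.mem_reverse.1 (List.getElem_mem _))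
  have hv : r'.reverse = tab r'.length fun i => f (base + t.length + i) := by
    conv_lhs => rw [eq_tab r'.reverse, List.length_reverse]
    refine tab_congr fun i hi => ?_
    rw [add_assoc, get _ (by omega), List.getD_append_right _ _ _ _ (by omega),
      Nat.add_sub_cancel_left, List.getD_append _ _ _ _ (by simpa using hi)]
  have hr0 : 0 < r'.length := by
    obtain ⟨k, hk⟩ := hne
    by_contra h
    rcases lt_or_ge k (base + t.length) with h' | h'
    · exact hk (z1 k h')
    · exact hk (z2 k (by omega))
  refine ⟨⟨base + t.length, r'.length, r'.reverse⟩,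
    s + (2 * r.length + 1 + (s' + (2 * r'.length + 1 + (2 * r'.length + 1)))), ?_, ?_, ?_⟩
  · simp only [findSupport, run_bind, e5, run_rev, List.append_nil, e5', run_length, run_pure,
      List.length_reverse, Nat.add_zero]
  · have : r.length = r'.length + t'.length := by rw [hr]; simp
    simp at e4 e4' ⊢
    omega
  · rw [hv]
    have pos : ∀ {k}, ε < |f k| → f k ≠ 0 := fun {k} h h' => by
      rw [h', abs_zero] at h; exact absurd h (not_lt.2 hε)
    refine .of_tab hr0 z1 z2 (pos ?_) (pos ?_)
    · apply e3
      rw [hr, hv]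
      obtain ⟨d, hd⟩ : ∃ d, r'.length = d + 1 := ⟨r'.length - 1, by omega⟩
      rw [hd, tab_succ]; rfl
    · apply e3'
      have : r' = tab r'.length fun i => f (base + t.length + (r'.length - 1 - i)) := by
        have := congrArg List.reverse hv
        rwa [List.reverse_reverse, tab_reverse] at this
      obtain ⟨d, hd⟩ : ∃ d, r'.length = d + 1 := ⟨r'.length - 1, by omega⟩
      rw [this, hd, tab_succ]
      simp

end SparseDCT

/-! ### Reflected periodizations -/

/-- The reflected periodization of a vector of length `2 * n`. -/
def reflFold (n : ℕ) (g : ℕ → ℝ) (k : ℕ) : ℝ := if k < n then g k + g (2 * n - 1 - k) else 0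

theorem reflFold_of_lt {n k : ℕ} (g : ℕ → ℝ) (h : k < n) :
    reflFold n g k = g k + g (2 * n - 1 - k) :=
  if_pos h

theorem reflFold_of_ge {n k : ℕ} (g : ℕ → ℝ) (h : n ≤ k) : reflFold n g k = 0 := if_neg (by omega)

theorem c2_congr {n : ℕ} {f g : ℕ → ℝ} (h : ∀ k < n, f k = g k) (k : ℕ) : c2 n f k = c2 n g k :=
  Finset.sum_congr rfl fun l hl => by rw [h l (Finset.mem_range.1 hl)]

theorem c2_reflFold (n : ℕ) (g : ℕ → ℝ) (k : ℕ) :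
    c2 n (reflFold n g) k = Real.sqrt 2 * c2 (2 * n) g (2 * k) := by
  rw [← c2_two_mul]
  exact c2_congr (fun l hl => reflFold_of_lt g hl) k

section Periodizations

variable {J : ℕ} (x : Fin (2 ^ J) → ℝ)

theorem zeroExtend_of_ge {n : ℕ} (x : Fin n → ℝ) {k : ℕ} (h : n ≤ k) : zeroExtend x k = 0 :=
  dif_neg (by omega)

theorem zeroExtend_val {n : ℕ} (x : Fin n → ℝ) (k : Fin n) : zeroExtend x k = x k := by
  simp [zeroExtend]

theorem zeroExtend_dctII {n : ℕ} (x : Fin n → ℝ) {k : ℕ} (hk : k < n) :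
    zeroExtend (dctII x) k = c2 n (zeroExtend x) k := by
  rw [zeroExtend, dif_pos hk, dctII, Matrix.mulVec, dotProduct, c2,
    ← Fin.sum_univ_eq_sum_range (fun l => kerII n k l * zeroExtend x l)]
  refine Finset.sum_congr rfl fun l _ => ?_
  rw [zeroExtend_val, cosMatrixII, Matrix.of_apply, kerII, Nat.mod_eq_of_lt hk]

theorem reflPeriod_top : reflPeriod x J = zeroExtend x := by
  rw [reflPeriod, Nat.sub_self]; rfl

theorem reflPeriod_eq_reflFold {j : ℕ} (hj : j < J) :
    reflPeriod x j = reflFold (2 ^ j) (reflPeriod x (j + 1)) := by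
  obtain ⟨d, rfl⟩ := Nat.exists_eq_add_of_lt hj
  funext k
  rw [reflPeriod, reflPeriod, show j + d + 1 - j = d + 1 by omega,
    show j + d + 1 - (j + 1) = d by omega, reflPeriodAux, reflFold,
    show j + d + 1 - (d + 1) = j by omega, pow_succ']

theorem reflPeriod_of_ge {j k : ℕ} (hj : j ≤ J) (hk : 2 ^ j ≤ k) : reflPeriod x j k = 0 := by
  rcases hj.eq_or_lt with rfl | h
  · rw [reflPeriod_top, zeroExtend_of_ge x hk]
  · rw [reflPeriod_eq_reflFold x h, reflFold_of_ge _ hk]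

/-- The transforms of the reflected periodizations are contained in the transform of the vector. -/
theorem c2_reflPeriod {j : ℕ} (hj : j ≤ J) (k : ℕ) :
    c2 (2 ^ j) (reflPeriod x j) k =
      Real.sqrt (2 ^ (J - j)) * c2 (2 ^ J) (zeroExtend x) (2 ^ (J - j) * k) := by
  induction hj using Nat.decreasingInduction generalizing k with
  | self => simp [reflPeriod_top]
  | of_succ j hj ih =>
    rw [reflPeriod_eq_reflFold x hj, c2_reflFold, ← pow_succ', ih,
      show J - j = J - (j + 1) + 1 by omega, pow_succ', Real.sqrt_mul (by norm_num), mul_assoc]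
    congr 3; ring

/-- The rescaled samples at multiples of `2 ^ (J - j)` are the coefficients of `x^(j)`. -/
theorem sqrt_mul_sample {j k : ℕ} (hj : j ≤ J) (hk : k < 2 ^ j) :
    2 ^ (J - j) * k < 2 ^ J ∧ Real.sqrt (2 ^ (J - j)) * zeroExtend (dctII x) (2 ^ (J - j) * k) =
      c2 (2 ^ j) (reflPeriod x j) k := by
  have h : 2 ^ (J - j) * k < 2 ^ J := by
    calc 2 ^ (J - j) * k < 2 ^ (J - j) * 2 ^ j := by gcongr
      _ = 2 ^ J := by rw [← pow_add]; congr 1; omega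
  exact ⟨h, by rw [c2_reflPeriod x hj, zeroExtend_dctII x h]⟩

end Periodizations

/-- A nonzero vector `g` of length `n` that either has a support of length `m` whose first and last
entries do not cancel, or is supported in its first or in its last `m` entries. The reflected
periodizations of a vector of the first kind are of this form. -/
def IsShort (n m : ℕ) (g : ℕ → ℝ) : Prop :=
  (∃ a b, b < n ∧ b + 1 = a + m ∧ a ≤ b ∧ g a ≠ 0 ∧ g b ≠ 0 ∧ (Even m → g a + g b ≠ 0) ∧
    ∀ k, k < a ∨ b < k → g k = 0) ∨
  (∃ k, g k ≠ 0) ∧ ((∀ k, m ≤ k → g k = 0) ∨ ∀ k, (k + m < n ∨ n ≤ k) → g k = 0)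

/-- How a vector `g` of length `2 * n` with short support can be related to its periodization `f`:
it is supported in the first half, or in the second half, or near the middle. In the last case, the
two outermost positions that meet in the first support index of `f` enclose the support of `g`. -/
def Unfolds (n m : ℕ) (f g : ℕ → ℝ) : Prop :=
  ((∀ k < n, g k = f k) ∧ ∀ k, n ≤ k → g k = 0) ∨
  ((∀ k, (k < n ∨ 2 * n ≤ k) → g k = 0) ∧ ∀ k, n ≤ k → k < 2 * n → g k = f (2 * n - 1 - k)) ∨
  ∃ a < n, n ≤ a + m ∧ f a ≠ 0 ∧ (∀ k < a, f k = 0) ∧ ∀ k, (k < a ∨ 2 * n - 1 - a < k) → g k = 0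

/-- Folding preserves short support. If the support of `g` meets the middle, the outermost entry of
the folded vector is a boundary entry of `g`, or the sum of both if the support is symmetric to the
middle; in the latter case `m` is even and the sum does not vanish. This can happen only once:
afterwards the support lies in the last `m` entries, and then in the first ones. -/
theorem IsShort.folded {n m : ℕ} {g : ℕ → ℝ} (hmn : m ≤ n)
    (hg : ∀ k, 2 * n ≤ k → g k = 0) (h : IsShort (2 * n) m g) :
    IsShort n m (reflFold n g) ∧ Unfolds n m (reflFold n g) g := by
  have low (hz : ∀ k, n ≤ k → g k = 0) : ∀ k, reflFold n g k = g k := fun k => by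
    rcases lt_or_ge k n with hk | hk
    · rw [reflFold_of_lt g hk, hz (2 * n - 1 - k) (by omega), add_zero]
    · rw [reflFold_of_ge g hk, hz k hk]
  have high (hz : ∀ k < n, g k = 0) : ∀ k < n, reflFold n g k = g (2 * n - 1 - k) :=
    fun k hk => by rw [reflFold_of_lt g hk, hz k hk, zero_add]
  have lowU (hz : ∀ k, n ≤ k → g k = 0) : Unfolds n m (reflFold n g) g :=
    Or.inl ⟨fun k _ => (low hz k).symm, hz⟩
  have highU (hz : ∀ k < n, g k = 0) : Unfolds n m (reflFold n g) g := by
    refine Or.inr (Or.inl ⟨fun k hk => hk.elim (hz k) (hg k), fun k h1 h2 => ?_⟩)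
    rw [high hz _ (by omega)]
    congr 1; omega
  rcases h with ⟨a, b, hb, hm, hab, ha0, hb0, hev, hz⟩ | ⟨⟨k₀, hk₀⟩, h | h⟩
  · rcases lt_or_ge b n with hbn | hbn
    · have hz' : ∀ k, n ≤ k → g k = 0 := fun k hk => hz k (by omega)
      refine ⟨Or.inl ⟨a, b, hbn, hm, hab, ?_⟩, lowU hz'⟩
      simpa only [low hz'] using ⟨ha0, hb0, hev, hz⟩
    · rcases le_or_gt n a with han | han
      · have hz' : ∀ k < n, g k = 0 := fun k hk => hz k (by omega)
        refine ⟨Or.inl ⟨2 * n - 1 - b, 2 * n - 1 - a, by omega, by omega, by omega, ?_⟩, highU hz'⟩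
        rw [high hz' _ (by omega), high hz' _ (by omega),
          show 2 * n - 1 - (2 * n - 1 - b) = b by omega,
          show 2 * n - 1 - (2 * n - 1 - a) = a by omega, add_comm]
        refine ⟨hb0, ha0, hev, fun k hk => ?_⟩
        rcases lt_or_ge k n with hkn | hkn
        · rw [high hz' k hkn]; exact hz _ (by omega)
        · exact reflFold_of_ge g hkn
      · have hne : reflFold n g (min a (2 * n - 1 - b)) ≠ 0 := by
          rw [reflFold_of_lt g (by omega)]
          rcases lt_trichotomy a (2 * n - 1 - b) with hc | hc | hc
          · rw [min_eq_left hc.le, hz (2 * n - 1 - a) (by omega), add_zero]; exact ha0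
          · rw [min_eq_left hc.le, show 2 * n - 1 - a = b by omega]
            exact hev ⟨n - a, by omega⟩
          · rw [min_eq_right hc.le, hz (2 * n - 1 - b) (by omega), zero_add,
              show 2 * n - 1 - (2 * n - 1 - b) = b by omega]
            exact hb0
        have hz' : ∀ k < min a (2 * n - 1 - b), reflFold n g k = 0 := fun k hk => by
          rw [reflFold_of_lt g (by omega), hz k (by omega), hz (2 * n - 1 - k) (by omega), add_zero]
        refine ⟨Or.inr ⟨⟨_, hne⟩, Or.inr fun k hk => ?_⟩,
          Or.inr (Or.inr ⟨_, by omega, by omega, hne, hz', fun k hk => hz k (by omega)⟩)⟩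
        rcases lt_or_ge k n with hkn | hkn
        · exact hz' k (by omega)
        · exact reflFold_of_ge g hkn
  · have hz' : ∀ k, n ≤ k → g k = 0 := fun k hk => h k (by omega)
    refine ⟨Or.inr ⟨⟨k₀, by rwa [low hz']⟩, Or.inl fun k hk => ?_⟩, lowU hz'⟩
    rw [low hz', h k hk]
  · have hz' : ∀ k < n, g k = 0 := fun k hk => h k (by omega)
    have h1 : ¬ (k₀ + m < 2 * n ∨ 2 * n ≤ k₀) := fun h' => hk₀ (h k₀ h')
    refine ⟨Or.inr ⟨⟨2 * n - 1 - k₀, ?_⟩, Or.inl fun k hk => ?_⟩, highU hz'⟩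
    · rw [high hz' _ (by omega), show 2 * n - 1 - (2 * n - 1 - k₀) = k₀ by omega]
      exact hk₀
    · rcases lt_or_ge k n with hkn | hkn
      · rw [high hz' k hkn]; exact h _ (by omega)
      · exact reflFold_of_ge g hkn

theorem IsShort.exists_ne {n m : ℕ} {g : ℕ → ℝ} (h : IsShort n m g) : ∃ k, g k ≠ 0 := by
  rcases h with ⟨a, b, -, -, -, ha, -⟩ | ⟨h, -⟩
  · exact ⟨a, ha⟩
  · exact h

theorem IsShort.len_le {n m : ℕ} {g : ℕ → ℝ} (h : IsShort n m g) {B : Block}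
    (hB : B.Represents g) : B.len ≤ m := by
  have h0 := hB.len_pos
  rcases h with ⟨a, b, -, hm, -, -, -, -, hz⟩ | ⟨-, hz | hz⟩
  · have h3 : ¬ (B.first < a ∨ b < B.first) := fun h => hB.first_ne (hz _ h)
    have h4 : ¬ (B.first + B.len - 1 < a ∨ b < B.first + B.len - 1) :=
      fun h => hB.last_ne (hz _ h)
    omega
  · have h4 : ¬ (m ≤ B.first + B.len - 1) := fun h => hB.last_ne (hz _ h)
    omega
  · have h3 : ¬ (B.first + m < n ∨ n ≤ B.first) := fun h => hB.first_ne (hz _ h)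
    have h4 : ¬ (B.first + B.len - 1 + m < n ∨ n ≤ B.first + B.len - 1) :=
      fun h => hB.last_ne (hz _ h)
    omega

theorem HasShortSupport.isShort {n m : ℕ} {x : Fin n → ℝ} {μ ν : Fin n}
    (h : HasShortSupport x μ ν m) (hev : Even m → x μ + x ν ≠ 0) :
    IsShort n m (zeroExtend x) := by
  refine Or.inl ⟨μ, ν, ν.2, h.length, h.le, ?_⟩
  rw [zeroExtend_val, zeroExtend_val]
  refine ⟨h.first_ne, h.last_ne, hev, fun k hk => ?_⟩
  rw [zeroExtend]
  split_ifs with hk'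
  · exact h.zero_off ⟨k, hk'⟩ hk
  · rfl

/-- Above the starting level, a support of length at most `M` fills at most half of the vector. -/
theorem two_mul_le_two_pow {J M j : ℕ} (h1 : startLevel J M ≤ j) (h2 : j < J) :
    2 * M ≤ 2 ^ j := by
  have h3 : Nat.clog 2 M + 1 ≤ j := by rw [startLevel] at h1; omega
  calc 2 * M ≤ 2 * 2 ^ Nat.clog 2 M := by gcongr; exact Nat.le_pow_clog (by norm_num) M
    _ = 2 ^ (Nat.clog 2 M + 1) := by rw [pow_succ']
    _ ≤ 2 ^ j := Nat.pow_le_pow_right (by norm_num) h3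

section

variable {J : ℕ} {x : Fin (2 ^ J) → ℝ} {μ ν : Fin (2 ^ J)} {m M : ℕ}

theorem isShort_reflPeriod (h : HasShortSupport x μ ν m) (hev : Even m → x μ + x ν ≠ 0)
    (hmM : m ≤ M) {j : ℕ} (hj : j ≤ J) (hL : startLevel J M ≤ j) :
    IsShort (2 ^ j) m (reflPeriod x j) := by
  induction hj using Nat.decreasingInduction with
  | self => rw [reflPeriod_top]; exact h.isShort hev
  | of_succ j hj ih =>
    have h2 := two_mul_le_two_pow hL hj
    have ih := ih (by omega)
    rw [pow_succ'] at ih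
    rw [reflPeriod_eq_reflFold x hj]
    refine (ih.folded (by omega) fun k hk => reflPeriod_of_ge x hj ?_).1
    rwa [pow_succ']

theorem unfolds_reflPeriod (h : HasShortSupport x μ ν m) (hev : Even m → x μ + x ν ≠ 0)
    (hmM : m ≤ M) {j : ℕ} (hj : j < J) (hL : startLevel J M ≤ j) :
    Unfolds (2 ^ j) m (reflPeriod x j) (reflPeriod x (j + 1)) := by
  have h2 := two_mul_le_two_pow hL hj
  have ih := isShort_reflPeriod h hev hmM (j := j + 1) hj (by omega)
  rw [pow_succ'] at ih
  rw [reflPeriod_eq_reflFold x hj]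
  refine (ih.folded (by omega) fun k hk => reflPeriod_of_ge x hj ?_).2
  rwa [pow_succ']

end

/-! ### Unfolding without collision -/

open Finset in
/-- Finitely many of the functions `cos ((2k+1) θ)` determine a combination of point evaluations:
`cos ((2k+1) θ)` is `cos θ` times a polynomial of degree `k` in `cos 2θ`, so that the matrix of the
values at the points is equivalent to a Vandermonde matrix. -/
theorem eq_zero_of_sum_cos_odd {m : ℕ} {θ v : ℕ → ℝ} (hc : ∀ l < m, Real.cos (θ l) ≠ 0)
    (hinj : ∀ l < m, ∀ l' < m, Real.cos (2 * θ l) = Real.cos (2 * θ l') → l = l')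
    (h : ∀ k < m, ∑ l ∈ range m, Real.cos ((2 * k + 1) * θ l) * v l = 0) :
    ∀ l < m, v l = 0 := by
  -- by `2 cos 2θ cos ((2k+1)θ) = cos ((2k+3)θ) + cos ((2k-1)θ)`, powers of `cos 2θ` can be inserted
  have key : ∀ i k : ℕ, i + k < m →
      ∑ l ∈ range m, Real.cos (2 * θ l) ^ i * (Real.cos ((2 * k + 1) * θ l) * v l) = 0 := by
    intro i
    induction i with
    | zero => intro k hk; simpa using h k (by omega)
    | succ i ih =>
      intro k hk
      have e : ∀ l, Real.cos (2 * θ l) ^ (i + 1) * (Real.cos ((2 * k + 1) * θ l) * v l) =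
          (Real.cos (2 * θ l) ^ i * (Real.cos ((2 * (k + 1 : ℕ) + 1) * θ l) * v l) +
          Real.cos (2 * θ l) ^ i * (Real.cos ((2 * (k - 1 : ℤ) + 1) * θ l) * v l)) / 2 := by
        intro l
        have := cos_mul_cos_eq ((2 * k + 1) * θ l) (2 * θ l)
        rw [show (2 * (k : ℝ) + 1) * θ l + 2 * θ l = (2 * (k + 1 : ℕ) + 1) * θ l by push_cast; ring,
          show (2 * (k : ℝ) + 1) * θ l - 2 * θ l = (2 * (k - 1 : ℤ) + 1) * θ l by
            push_cast; ring] at this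
        calc _ = Real.cos (2 * θ l) ^ i *
              (Real.cos ((2 * k + 1) * θ l) * Real.cos (2 * θ l)) * v l := by ring
          _ = _ := by rw [this]; ring
      rw [sum_congr rfl fun l _ => e l, ← sum_div, sum_add_distrib, ih _ (by omega)]
      cases k with
      | zero =>
        have := ih 0 (by omega)
        have e2 : ∀ l, Real.cos ((2 * (-1) + 1) * θ l) = Real.cos ((2 * 0 + 1) * θ l) := fun l => by
          rw [← Real.cos_neg]; congr 1; ring
        push_cast at this ⊢
        simp only [e2, this]
        simp
      | succ k =>
        have := ih k (by omega)
        push_cast at this ⊢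
        simp only [add_sub_cancel_right, this]
        simp
  have hv : (fun l : Fin m => Real.cos (θ l) * v l) = 0 := by
    apply Matrix.eq_zero_of_forall_pow_sum_mul_pow_eq_zero
      (f := fun l : Fin m => Real.cos (2 * θ l))
    · intro l l' hl
      exact Fin.ext (hinj l l.2 l' l'.2 hl)
    · intro i
      rw [Fin.sum_univ_eq_sum_range (fun l => Real.cos (θ l) * v l * Real.cos (2 * θ l) ^ (i : ℕ)),
        ← key i 0 (by simp)]
      refine sum_congr rfl fun l _ => ?_
      simp; ring
  intro l hl
  have := congrFun hv ⟨l, hl⟩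
  simpa [hc l hl] using this

/-- The nodes of the transform of type IV lie between `0` and `π / 2`. -/
theorem angle_mem {n l : ℕ} (h : l < n) :
    0 < (2 * l + 1) * Real.pi / (4 * n) ∧ (2 * l + 1) * Real.pi / (4 * n) < Real.pi / 2 := by
  have hn : (0 : ℝ) < n := by exact_mod_cast (by omega : 0 < n)
  have hk' : (l : ℝ) + 1 ≤ n := by exact_mod_cast h
  have hpi := Real.pi_pos
  refine ⟨by positivity, ?_⟩
  rw [div_lt_iff₀ (by positivity)]; nlinarith

theorem cos_angle_pos {n l : ℕ} (h : l < n) : 0 < Real.cos ((2 * l + 1) * Real.pi / (4 * n)) := by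
  obtain ⟨h1, h2⟩ := angle_mem h
  exact Real.cos_pos_of_mem_Ioo ⟨by linarith, h2⟩

open Finset in
/-- A nonzero vector with support length `m` has a nonzero value among its first `m` cosine sums of
odd frequency. -/
theorem exists_sum_cos_odd_ne {n a m : ℕ} {f : ℕ → ℝ} (ham : a + m ≤ n) (hm : 0 < m)
    (ha : f a ≠ 0) : ∃ k < m, ∑ l ∈ range m,
      Real.cos ((2 * k + 1) * (2 * (a + l : ℕ) + 1) * Real.pi / (4 * n)) * f (a + l) ≠ 0 := by
  by_contra! hcon
  have hn : (0 : ℝ) < n := by exact_mod_cast (by omega : 0 < n)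
  apply ha
  refine eq_zero_of_sum_cos_odd (m := m) (v := fun l => f (a + l))
    (θ := fun l => (2 * (a + l : ℕ) + 1) * Real.pi / (4 * n)) ?_ ?_ ?_ 0 hm
  · intro l hl
    exact (cos_angle_pos (by omega)).ne'
  · intro l hl l' hl' h
    obtain ⟨h1, h2⟩ := angle_mem (show a + l < n by omega)
    obtain ⟨h3, h4⟩ := angle_mem (show a + l' < n by omega)
    have := Real.injOn_cos ⟨by linarith, by linarith⟩ ⟨by linarith, by linarith⟩ h
    have hpi := Real.pi_pos.ne'
    field_simp at this
    push_cast at this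
    have : (l : ℝ) = l' := by linarith
    exact_mod_cast this
  · intro k hk
    rw [← hcon k hk]
    refine sum_congr rfl fun l _ => ?_
    congr 2; ring

open Finset in
theorem sum_eq_sum_support {n a m : ℕ} {f : ℕ → ℝ} (ham : a + m ≤ n) (h1 : ∀ k < a, f k = 0)
    (h2 : ∀ k, a + m ≤ k → f k = 0) (F : ℕ → ℝ) :
    ∑ l ∈ range n, F l * f l = ∑ l ∈ range m, F (a + l) * f (a + l) := by
  obtain ⟨c, rfl⟩ := Nat.exists_eq_add_of_le ham
  rw [sum_range_add, sum_range_add, sum_eq_zero, zero_add, add_eq_left, sum_eq_zero]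
  · intro l _; rw [h2 _ (by omega), mul_zero]
  · intro l hl; rw [h1 _ (mem_range.1 hl), mul_zero]

theorem sqrt_two_div_div_sqrt_two (n : ℕ) :
    Real.sqrt (2 / n) / Real.sqrt 2 = 1 / Real.sqrt n := by
  rw [Real.sqrt_div (by norm_num)]
  have : Real.sqrt 2 ≠ 0 := by positivity
  field_simp

namespace SparseDCT
open Prog

attribute [local simp] run_pure run_bind run_tick run_sample run_radd run_rsub run_rmul run_rdiv
  run_rabs run_rsqrt run_cosPi run_cast run_rlt run_nadd run_nsub run_nmul run_shl run_clog run_nlt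
  run_cons run_sqrtTwoPow

/-- If the support of the periodization is far enough from the end, then the support of the next
one is not near the middle; the sign of a nonzero coefficient of odd index decides between the two
remaining cases. -/
theorem run_stepNoCollision {J j m M : ℕ} {x : Fin (2 ^ J) → ℝ} {B : Block} (hj : j < J)
    (hmM : m ≤ M) (hB : B.Represents (reflPeriod x j)) (hfirst : B.first + M < 2 ^ j)
    (hU : Unfolds (2 ^ j) m (reflPeriod x j) (reflPeriod x (j + 1))) :
    ∃ B' s S, (stepNoCollision J j B).run (zeroExtend (dctII x)) = ⟨B', s, S⟩ ∧
      s ≤ 18 * B.len + 27 ∧ S.length = B.len ∧ (∀ i ∈ S, i < 2 ^ J) ∧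
      B'.Represents (reflPeriod x (j + 1)) ∧ B'.len = B.len ∧
      (B'.first = B.first ∨ B'.first + B.len + B.first = 2 ^ (j + 1)) := by
  set f := reflPeriod x j with hf
  set g := reflPeriod x (j + 1) with hg
  set a := B.first with ha
  set y := zeroExtend (dctII x) with hy
  have hlen : a + B.len ≤ 2 ^ j := by
    by_contra hcon
    exact hB.last_ne (reflPeriod_of_ge x hj.le (by omega))
  have hlen0 := hB.len_pos
  have hgz : ∀ k, 2 * 2 ^ j ≤ k → g k = 0 := fun k hk => reflPeriod_of_ge x hj (by rwa [pow_succ'])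
  have hfz : ∀ k, 2 ^ j ≤ k → f k = 0 := fun k hk => reflPeriod_of_ge x hj.le hk
  let u : ℕ → ℝ := fun i => (∑ l ∈ Finset.range B.len,
      Real.cos ((2 * i + 1) * (2 * (a + l : ℕ) + 1) * Real.pi / (4 * (2 ^ j : ℕ))) * f (a + l)) /
        Real.sqrt (2 ^ j)
  have hodd : ∀ σ : ℝ, (∀ l < 2 ^ j, g l - g (2 * 2 ^ j - 1 - l) = σ * f l) →
      ∀ i, c2 (2 ^ (j + 1)) g (2 * i + 1) = σ * u i := by
    intro σ hσ i
    rw [pow_succ', c2_two_mul_add_one, sqrt_two_div_div_sqrt_two,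
      Finset.sum_congr rfl fun l hl => by rw [hσ l (Finset.mem_range.1 hl), mul_left_comm],
      ← Finset.mul_sum, sum_eq_sum_support hlen (fun k => hB.eq_zero_of_lt)
        (fun k => hB.eq_zero_of_ge)]
    simp only [u]
    push_cast
    ring
  -- the coefficients of odd index are `± u`, and the sign tells the two cases apart
  have hcase : ∃ σ : ℝ, (∀ i, c2 (2 ^ (j + 1)) g (2 * i + 1) = σ * u i) ∧
      ((σ = 1 ∧ ∀ k, g k = f k) ∨
        (σ = -1 ∧ (∀ k < 2 ^ j, g k = 0) ∧
          ∀ k, 2 ^ j ≤ k → k < 2 * 2 ^ j → g k = f (2 * 2 ^ j - 1 - k))) := by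
    rcases hU with ⟨h1, h2⟩ | ⟨h1, h2⟩ | ⟨b, hb, hbm, hb0, hbz, -⟩
    · refine ⟨1, hodd 1 fun l hl => ?_, Or.inl ⟨rfl, fun k => ?_⟩⟩
      · rw [h1 l hl, h2 _ (by omega)]; ring
      · rcases lt_or_ge k (2 ^ j) with hk | hk
        · exact h1 k hk
        · rw [h2 k hk, hfz k hk]
    · refine ⟨-1, hodd (-1) fun l hl => ?_, Or.inr ⟨rfl, fun k hk => h1 k (Or.inl hk), h2⟩⟩
      rw [h1 l (Or.inl hl), h2 _ (by omega) (by omega),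
        show 2 * 2 ^ j - 1 - (2 * 2 ^ j - 1 - l) = l by omega]; ring
    · exact absurd (hbz a (by omega)) hB.first_ne
  obtain ⟨σ, hσ, hcase⟩ := hcase
  have hσ1 : |σ| = 1 := by rcases hcase with ⟨h, -⟩ | ⟨h, -⟩ <;> simp [h]
  have hsq : (0 : ℝ) < Real.sqrt (2 ^ j) := by positivity
  have hsamp : ∀ i < B.len, 1 * 2 ^ (J - (j + 1)) + 2 * 2 ^ (J - (j + 1)) * i < 2 ^ J ∧
      Real.sqrt (2 ^ (J - (j + 1))) * y (1 * 2 ^ (J - (j + 1)) + 2 * 2 ^ (J - (j + 1)) * i) =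
        σ * u i := by
    intro i hi
    have := sqrt_mul_sample x (j := j + 1) (k := 2 * i + 1) hj (by rw [pow_succ']; omega)
    rw [show 1 * 2 ^ (J - (j + 1)) + 2 * 2 ^ (J - (j + 1)) * i =
      2 ^ (J - (j + 1)) * (2 * i + 1) by ring]
    exact ⟨this.1, this.2.trans (hσ i)⟩
  obtain ⟨bk, b, s, h1, h2, -, h4, h5⟩ := run_argmaxAbs_tab y 1 1 0 B.len fun i => σ * u i
  -- the search starts from the value `0`, so that a nonzero coefficient exists among those compared
  have hbest : ∃ i, bk = 1 + 2 * i ∧ b = σ * u i ∧ u i ≠ 0 := by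
    obtain ⟨k, hk, hne⟩ := exists_sum_cos_odd_ne (f := f) hlen hlen0 hB.first_ne
    have hpos : 0 < |b| := by
      refine lt_of_lt_of_le ?_ (h4 k hk)
      rw [abs_mul, hσ1, one_mul]
      exact abs_pos.2 (div_ne_zero hne hsq.ne')
    rcases h5 with ⟨-, h5⟩ | ⟨i, -, h5, h6⟩
    · rw [h5, abs_zero] at hpos; exact absurd hpos (lt_irrefl _)
    · refine ⟨i, h5, h6, fun h => ?_⟩
      rw [h6, h, mul_zero, abs_zero] at hpos; exact absurd hpos (lt_irrefl _)
  obtain ⟨i, hbk, hb, hui⟩ := hbest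
  have hvals : B.vals = tab B.len fun i => f (a + i) := hB.vals_eq
  have hsamples : (samples (Real.sqrt (2 ^ (J - (j + 1)))) (2 * 2 ^ (J - (j + 1))) B.len
      (1 * 2 ^ (J - (j + 1)))).run y = ⟨tab B.len fun i => σ * u i, 5 * B.len + 1,
        (List.range B.len).map fun i => 1 * 2 ^ (J - (j + 1)) + 2 * 2 ^ (J - (j + 1)) * i⟩ := by
    rw [run_samples]
    congr 1
    exact tab_congr fun i hi => (hsamp i hi).2
  have hu : (∑ l ∈ Finset.range B.len, Real.cos ((bk : ℕ) * ((2 * a + 1 : ℕ) + 2 * l) * Real.pi /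
      (4 * 2 ^ j : ℕ)) * f (a + l)) / Real.sqrt (2 ^ j) = u i := by
    simp only [u]
    congr 1
    refine Finset.sum_congr rfl fun l _ => ?_
    rw [hbk]
    congr 2
    push_cast; ring
  have hS : ((List.range B.len).map fun i =>
      1 * 2 ^ (J - (j + 1)) + 2 * 2 ^ (J - (j + 1)) * i).length = B.len ∧
      ∀ i ∈ (List.range B.len).map fun i =>
        1 * 2 ^ (J - (j + 1)) + 2 * 2 ^ (J - (j + 1)) * i, i < 2 ^ J := by
    refine ⟨by simp, fun i hi => ?_⟩
    obtain ⟨i', hi', rfl⟩ := List.mem_map.1 hi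
    exact (hsamp i' (List.mem_range.1 hi')).1
  rcases hcase with ⟨rfl, hgf⟩ | ⟨rfl, hg1, hg2⟩
  · have htest : |u i - b| < |u i + b| := by
      rw [hb, one_mul, sub_self, abs_zero]
      exact abs_pos.2 (by rw [← two_mul]; exact mul_ne_zero two_ne_zero hui)
    have hgf' : g = f := funext hgf
    refine ⟨B, s + (11 * B.len + 22), _, ?_, ?_, hS.1, hS.2, by rw [hgf']; exact hB, rfl,
      Or.inl rfl⟩
    · rw [stepNoCollision]
      simp only [run_bind, run_tick, run_nadd, run_nsub, run_sqrtTwoPow, run_shl, hsamples, h1,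
        run_nmul, hvals, run_cosSum_tab, run_rdiv, ← ha, hu, run_rsub, run_radd, run_rabs, run_rlt,
        htest, decide_true, if_true, run_pure, List.nil_append, List.append_nil]
      simp only [Outcome.mk.injEq, true_and, and_true]
      ring
    · omega
  · have htest : ¬ |u i - b| < |u i + b| := by
      rw [hb]; simp
    have hpow : 2 ^ (j + 1) = 2 * 2 ^ j := pow_succ' 2 j
    refine ⟨⟨2 ^ (j + 1) - B.len - a, B.len, tab B.len fun i =>
      g (2 ^ (j + 1) - B.len - a + i)⟩, s + (13 * B.len + 26), _, ?_, ?_, hS.1, hS.2, ?_, rfl,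
      Or.inr ?_⟩
    · rw [stepNoCollision]
      simp only [run_bind, run_tick, run_nadd, run_nsub, run_sqrtTwoPow, run_shl, hsamples, h1,
        run_nmul, hvals, run_cosSum_tab, run_rdiv, ← ha, hu, run_rsub, run_radd, run_rabs, run_rlt,
        htest, decide_false, run_pure, List.nil_append, List.append_nil, run_rev, tab_reverse,
        Bool.false_eq_true, if_false, tab_length]
      have : (tab B.len fun i => f (a + (B.len - 1 - i))) =
          tab B.len fun i => g (2 ^ (j + 1) - B.len - a + i) := by
        refine tab_congr fun i hi => ?_
        rw [hg2 _ (by omega) (by omega)]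
        congr 1; omega
      rw [this, one_mul (2 ^ (j + 1))]
      simp only [Outcome.mk.injEq, true_and, and_true]
      ring
    · omega
    · refine .of_tab hlen0 (fun k hk => ?_) (fun k hk => ?_) ?_ ?_
      · rcases lt_or_ge k (2 ^ j) with hkj | hkj
        · exact hg1 k hkj
        · rw [hg2 _ hkj (by omega)]
          exact hB.eq_zero_of_ge (by omega)
      · rcases lt_or_ge k (2 * 2 ^ j) with hkj | hkj
        · rw [hg2 _ (by omega) hkj]
          exact hB.eq_zero_of_lt (by omega)
        · exact hgz k hkj
      · rw [hg2 _ (by omega) (by omega)]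
        convert hB.last_ne using 2; omega
      · rw [hg2 _ (by omega) (by omega)]
        convert hB.first_ne using 2; omega
    · dsimp only; omega

end SparseDCT

/-! ### Unfolding with collision -/

/-- In each of the cases, the next periodization is supported between the first support index of
the current one and its mirror image. -/
theorem Unfolds.support {n m : ℕ} {f g : ℕ → ℝ} (hU : Unfolds n m f g) {B : Block}
    (hB : B.Represents f) (hn : B.first < n) {k : ℕ} (hk : g k ≠ 0) :
    B.first ≤ k ∧ k + B.first < 2 * n := by
  rcases hU with ⟨h1, h2⟩ | ⟨h1, h2⟩ | ⟨b, hb, -, hb0, hbz, h⟩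
  · have h3 : k < n := not_le.1 fun h => hk (h2 k h)
    have h4 : B.first ≤ k := not_lt.1 fun h => hk (by rw [h1 k h3, hB.eq_zero_of_lt h])
    omega
  · have h3 : ¬ (k < n ∨ 2 * n ≤ k) := fun h => hk (h1 k h)
    have h4 : B.first ≤ 2 * n - 1 - k :=
      not_lt.1 fun h => hk (by rw [h2 k (by omega) (by omega), hB.eq_zero_of_lt h])
    omega
  · have h3 : ¬ (k < b ∨ 2 * n - 1 - b < k) := fun h' => hk (h k h')
    have h4 : B.first ≤ b := not_lt.1 fun h => hb0 (hB.eq_zero_of_lt h)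
    omega

theorem c4_congr {n : ℕ} {f g : ℕ → ℝ} (h : ∀ k < n, f k = g k) (k : ℕ) : c4 n f k = c4 n g k := by
  rw [c4, c4]
  congr 1
  exact Finset.sum_congr rfl fun l hl => by rw [h l (Finset.mem_range.1 hl)]

theorem c4_const_mul (n : ℕ) (c : ℝ) (f : ℕ → ℝ) (k : ℕ) :
    c4 n (fun l => c * f l) k = c * c4 n f k := by
  simp only [c4, Finset.mul_sum]
  exact Finset.sum_congr rfl fun l _ => by ring

open Finset in
/-- The coefficients with odd index of a vector that is supported in the `2 * w` entries around the
middle, as a sine transform of the antisymmetric part. -/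
theorem c2_odd_of_support {n w : ℕ} {g : ℕ → ℝ} (hw : w ≤ n) (h1 : ∀ k, k + w < n → g k = 0)
    (h2 : ∀ k, n + w ≤ k → g k = 0) (k : ℕ) :
    c2 (2 * n) g (2 * k + 1) = 1 / Real.sqrt n * ((-1) ^ k * ∑ r ∈ range w,
      Real.sin ((2 * k + 1) * ((2 * r + 1) * Real.pi / (4 * n))) * (g (n - 1 - r) - g (n + r))) := by
  rw [c2_two_mul_add_one, sqrt_two_div_div_sqrt_two, mul_sum (range w), ← sum_range_reflect]
  congr 1
  rw [← sum_subset (range_mono hw)]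
  · refine sum_congr rfl fun r hr => ?_
    have hr := mem_range.1 hr
    have hn : (0 : ℝ) < n := by exact_mod_cast (by omega : 0 < n)
    have e : ((n - 1 - r : ℕ) : ℝ) = n - 1 - r := by
      rw [Nat.cast_sub (by omega), Nat.cast_sub (by omega)]; push_cast; ring
    have : (2 * (k : ℝ) + 1) * (2 * ((n - 1 - r : ℕ) : ℝ) + 1) * Real.pi / (4 * n) =
        (Real.pi / 2 - (2 * k + 1) * ((2 * r + 1) * Real.pi / (4 * n))) + k * Real.pi := by
      rw [e]; field_simp; ring
    rw [this, Real.cos_add_nat_mul_pi, Real.cos_pi_div_two_sub, mul_assoc,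
      show 2 * n - 1 - (n - 1 - r) = n + r by omega]
  · intro r hr hr'
    have hr := mem_range.1 hr
    have hr' : ¬ r < w := fun h => hr' (mem_range.2 h)
    rw [h1 _ (by omega), h2 _ (by omega)]
    ring

open Finset in
/-- The differences of neighbouring coefficients of odd index, at equidistant positions and in
reversed order, form a transform of type IV of the antisymmetric part, with weights. -/
theorem c2_odd_sub {a w n : ℕ} {g : ℕ → ℝ} (hn : n = 2 * (a * w)) (ha : 0 < a)
    (h1 : ∀ k, k + w < n → g k = 0) (h2 : ∀ k, n + w ≤ k → g k = 0) {p : ℕ} (hp : p < w) :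
    c2 (2 * n) g (2 * (a * (2 * (w - 1 - p) + 1)) + 1) -
      c2 (2 * n) g (2 * (a * (2 * (w - 1 - p) + 1) - 1) + 1) =
    (-1) ^ a * (1 / Real.sqrt a) * c4 w (fun r =>
      (-1) ^ r * Real.cos ((2 * r + 1) * Real.pi / (4 * n)) * (g (n - 1 - r) - g (n + r))) p := by
  have hwn : w ≤ n := by nlinarith
  have hw0 : (0 : ℝ) < w := by exact_mod_cast (by omega : 0 < w)
  have ha0 : (0 : ℝ) < a := by exact_mod_cast ha
  have hnr : (n : ℝ) = 2 * (a * w) := by rw [hn]; push_cast; ring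
  set q := w - 1 - p with hq
  have hqr : (q : ℝ) = w - 1 - p := by
    rw [hq, Nat.cast_sub (by omega), Nat.cast_sub (by omega)]; push_cast; ring
  obtain ⟨k, hk⟩ : ∃ k, a * (2 * q + 1) = k + 1 :=
    Nat.exists_eq_succ_of_ne_zero (by positivity)
  have hkr : (k : ℝ) + 1 = a * (2 * q + 1) := by exact_mod_cast hk.symm
  have hsign : (-1 : ℝ) ^ (k + 1) = (-1) ^ a := by
    have : ((-1 : ℝ) ^ a) ^ 2 = 1 := by rw [← pow_mul, mul_comm, pow_mul]; simp
    rw [← hk, pow_mul, pow_succ, pow_mul, this, one_pow, one_mul]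
  have hsqrt : Real.sqrt n = Real.sqrt 2 * (Real.sqrt a * Real.sqrt w) := by
    rw [hnr, Real.sqrt_mul (by norm_num), Real.sqrt_mul ha0.le]
  have hs2 : Real.sqrt 2 * Real.sqrt 2 = 2 := Real.mul_self_sqrt (by norm_num)
  have hs2' : Real.sqrt 2 ≠ 0 := by positivity
  have hsw : Real.sqrt w ≠ 0 := by positivity
  have hsa : Real.sqrt a ≠ 0 := by positivity
  have hfac : (-1) ^ a * (1 / Real.sqrt a) * Real.sqrt (2 / w) =
      1 / Real.sqrt n * ((-1) ^ a * 2) := by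
    rw [hsqrt, Real.sqrt_div (by norm_num)]
    field_simp
    rw [sq, hs2]
  rw [hk, Nat.add_sub_cancel, c2_odd_of_support hwn h1 h2, c2_odd_of_support hwn h1 h2, ← mul_sub,
    hsign, show (-1 : ℝ) ^ k = - (-1) ^ a by rw [← hsign, pow_succ]; ring, neg_mul, sub_neg_eq_add,
    ← mul_add, ← sum_add_distrib, c4, ← mul_assoc ((-1) ^ a * (1 / Real.sqrt a)), hfac, mul_assoc,
    mul_assoc ((-1) ^ a)]
  congr 2
  rw [mul_sum]
  refine sum_congr rfl fun r _ => ?_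
  set φ := (2 * (r : ℝ) + 1) * Real.pi / (4 * n) with hφ
  have hsin : Real.sin (2 * (k + 1) * φ) =
      (-1) ^ r * Real.cos ((2 * p + 1) * (2 * r + 1) * Real.pi / (4 * w)) := by
    have : 2 * ((k : ℝ) + 1) * φ =
        (Real.pi / 2 - (2 * p + 1) * (2 * r + 1) * Real.pi / (4 * w)) + r * Real.pi := by
      rw [hkr, hφ, hnr, hqr]; field_simp; ring
    rw [this, Real.sin_add_nat_mul_pi, Real.sin_pi_div_two_sub]
  have e1 : (2 * ((k + 1 : ℕ) : ℝ) + 1) * φ = 2 * (k + 1) * φ + φ := by push_cast; ring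
  have e2 : (2 * (k : ℝ) + 1) * φ = 2 * (k + 1) * φ - φ := by ring
  rw [e1, e2, Real.sin_add, Real.sin_sub, hsin]
  ring

/-- The antisymmetric part of a vector that is supported around the middle is recovered from the
transform of type IV of the differences of neighbouring coefficients of odd index. -/
theorem c4_odd_sub {a w n : ℕ} {g : ℕ → ℝ} (hn : n = 2 * (a * w)) (ha : 0 < a)
    (h1 : ∀ k, k + w < n → g k = 0) (h2 : ∀ k, n + w ≤ k → g k = 0) {r : ℕ} (hr : r < w) :
    c4 w (fun p => c2 (2 * n) g (2 * (a * (2 * (w - 1 - p) + 1)) + 1) -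
      c2 (2 * n) g (2 * (a * (2 * (w - 1 - p) + 1) - 1) + 1)) r =
    (-1) ^ a * (1 / Real.sqrt a) *
      ((-1) ^ r * Real.cos ((2 * r + 1) * Real.pi / (4 * n)) * (g (n - 1 - r) - g (n + r))) := by
  rw [c4_congr fun p hp => c2_odd_sub hn ha h1 h2 hp, c4_const_mul, c4_c4 _ hr]

namespace SparseDCT
open Prog

attribute [local simp] run_pure run_bind run_tick run_sample run_radd run_rsub run_rmul run_rdiv
  run_rabs run_rsqrt run_cosPi run_cast run_rlt run_nadd run_nsub run_nmul run_shl run_clog run_nlt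
  run_cons run_sqrtTwoPow

theorem run_zipWith_rsub (y : ℕ → ℝ) (l l' : List ℝ) : (zipWith rsub l l').run y =
    ⟨List.zipWith (fun a b => a - b) l l', 3 * min l.length l'.length + 1, []⟩ :=
  run_zipWith y (c := 1) (fun _ _ => rfl) l l'

theorem run_zipWith_combine (y : ℕ → ℝ) (c d : ℝ) (l l' : List ℝ) :
    (zipWith (fun a a' => do
      let f ← rmul c a
      let g ← rmul d a'
      radd f g) l l').run y =
    ⟨List.zipWith (fun a b => c * a + d * b) l l', 5 * min l.length l'.length + 1, []⟩ :=
  run_zipWith y (c := 3) (fun _ _ => by simp) l l'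

theorem run_map_threshold (y : ℕ → ℝ) (ε : ℝ) (l : List ℝ) :
    (map (fun a => do
      let f ← rabs a
      let big ← rlt ε f
      if big then pure a else pure 0) l).run y =
    ⟨l.map fun a => if ε < |a| then a else 0, 4 * l.length + 1, []⟩ :=
  run_map y (c := 2) (fun a => by by_cases h : ε < |a| <;> simp [h]) l

/-- A conditional in front of a continuation is elaborated with two copies of the continuation;
this merges them. -/
theorem ite_bind {α γ : Type} (b : Bool) (p q : Prog α) (F : α → Prog γ) :
    (if b = true then p >>= F else q >>= F) = (if b = true then p else q) >>= F := by
  cases b <;> rfl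

/-- The factor `(-1) ^ (2 ^ h)` of the collision step is `-1` only for `h = 0`. -/
theorem run_sign (y : ℕ → ℝ) (h : ℕ) (c : ℝ) :
    ∃ t ≤ 1, ((if decide (0 < h) = true then pure c else rsub 0 c : Prog ℝ)).run y =
      ⟨(-1) ^ 2 ^ h * c, t, []⟩ := by
  rcases Nat.eq_zero_or_pos h with rfl | hh
  · exact ⟨1, le_rfl, by simp⟩
  · refine ⟨0, by omega, ?_⟩
    have : Even (2 ^ h) := (Nat.even_pow' (by omega)).2 even_two
    simp [hh, this.neg_one_pow]

/-- Padding the stored entries with zeros on both sides gives the last `w` entries of the vector.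
-/
theorem append_zeros_eq_tab {B : Block} {f : ℕ → ℝ} (hB : B.Represents f) {n w : ℕ}
    (hlen : B.first + B.len ≤ n) (hw : n - B.first ≤ w) (hwn : w ≤ n) :
    List.replicate (w - (n - B.first)) 0 ++
      (B.vals ++ List.replicate (n - B.first - B.len) 0) = tab w fun i => f (n - w + i) := by
  have h0 : ∀ k, List.replicate k (0 : ℝ) = tab k fun _ => 0 := fun k => by
    rw [eq_tab (List.replicate k 0), List.length_replicate]
    refine tab_congr fun i hi => ?_
    rw [List.getD_eq_getElem _ _ (by simpa using hi), List.getElem_replicate]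
  rw [h0, h0, hB.vals_eq, tab_append, tab_append,
    show w - (n - B.first) + (B.len + (n - B.first - B.len)) = w by omega]
  refine tab_congr fun i hi => ?_
  split_ifs with h1 h2
  · exact (hB.eq_zero_of_lt (by omega)).symm
  · congr 1; omega
  · exact (hB.eq_zero_of_ge (by omega)).symm

set_option maxHeartbeats 400000 in
/-- The collision step recovers the next periodization: the sums of mirrored entries are the
entries of the current one, and their differences come from `c4_odd_sub`. The new support lies
between the old first support index and its mirror image, which is what excludes further
collisions. -/
theorem run_stepCollision {J j m M : ℕ} {ε : ℝ} {x : Fin (2 ^ J) → ℝ} {B : Block} (hj : j < J)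
    (hM : Nat.clog 2 M + 1 ≤ j) (hB : B.Represents (reflPeriod x j))
    (hfirst : 2 ^ j ≤ B.first + M)
    (hU : Unfolds (2 ^ j) m (reflPeriod x j) (reflPeriod x (j + 1)))
    (hne : ∃ k, reflPeriod x (j + 1) k ≠ 0) (hε : 0 ≤ ε)
    (hbig : ∀ k, reflPeriod x (j + 1) k ≠ 0 → ε < |reflPeriod x (j + 1) k|) :
    ∃ B' s S, (stepCollision J ε j B).run (zeroExtend (dctII x)) = ⟨B', s, S⟩ ∧
      s ≤ (41 * Nat.clog 2 M + 200) * 2 ^ Nat.clog 2 M ∧ S.length ≤ 2 * 2 ^ Nat.clog 2 M ∧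
      (∀ i ∈ S, i < 2 ^ J) ∧ B'.Represents (reflPeriod x (j + 1)) ∧
      B.first ≤ B'.first ∧ B'.first + B.first < 2 ^ (j + 1) := by
  set f := reflPeriod x j with hf
  set g := reflPeriod x (j + 1) with hg
  set y := zeroExtend (dctII x) with hy
  have hlen0 := hB.len_pos
  have hlen : B.first + B.len ≤ 2 ^ j := by
    by_contra hcon
    exact hB.last_ne (reflPeriod_of_ge x hj.le (by omega))
  have hsupp : ∀ k, g k ≠ 0 → B.first ≤ k ∧ k + B.first < 2 * 2 ^ j :=
    fun k hk => Unfolds.support hU hB (by omega) hk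
  obtain ⟨e, he⟩ : ∃ e, e = Nat.clog 2 (2 ^ j - B.first) := ⟨_, rfl⟩
  have heM : e ≤ Nat.clog 2 M := he ▸ Nat.clog_mono_right 2 (by omega)
  have hwM : 2 ^ e ≤ 2 ^ Nat.clog 2 M := Nat.pow_le_pow_right (by norm_num) heM
  have hmt : 2 ^ j - B.first ≤ 2 ^ e := he ▸ Nat.le_pow_clog (by norm_num) _
  have hw0 : 0 < 2 ^ e := by positivity
  have ha0 : 0 < 2 ^ (j - (e + 1)) := by positivity
  have hn : 2 ^ j = 2 * (2 ^ (j - (e + 1)) * 2 ^ e) := by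
    rw [← pow_add, ← pow_succ']; congr 1; omega
  have hpow : 2 ^ (J - (e + 1)) = 2 ^ (J - (j + 1)) * (2 * 2 ^ (j - (e + 1))) := by
    rw [← pow_succ', ← pow_add]; congr 1; omega
  have hwn : 2 ^ e ≤ 2 ^ j := Nat.pow_le_pow_right (by norm_num) (by omega)
  have h1 : ∀ k, k + 2 ^ e < 2 ^ j → g k = 0 := fun k hk => by
    by_contra h; have := hsupp k h; omega
  have h2 : ∀ k, 2 ^ j + 2 ^ e ≤ k → g k = 0 := fun k hk => by
    by_contra h; have := hsupp k h; omega
  set w := 2 ^ e with hw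
  set a := 2 ^ (j - (e + 1)) with ha
  -- the sampled values
  have hsamp : ∀ (k : ℕ), 2 * k + 1 < 2 ^ (j + 1) → 2 ^ (J - (j + 1)) * (2 * k + 1) < 2 ^ J ∧
      Real.sqrt (2 ^ (J - (j + 1))) * y (2 ^ (J - (j + 1)) * (2 * k + 1)) =
        c2 (2 * 2 ^ j) g (2 * k + 1) := fun k hk => by
    have := sqrt_mul_sample x (j := j + 1) hj hk
    rw [pow_succ' 2 j] at this
    exact this
  have hbound : ∀ p < w, a * (2 * p + 1) < 2 ^ j := fun p hp => by
    rw [hn]; nlinarith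
  have hi0 : ∀ p, 1 * 2 ^ (J - (e + 1)) + 1 * 2 ^ (J - (j + 1)) + 2 * 2 ^ (J - (e + 1)) * p =
      2 ^ (J - (j + 1)) * (2 * (a * (2 * p + 1)) + 1) := fun p => by rw [hpow]; ring
  have hi1 : ∀ p, 1 * 2 ^ (J - (e + 1)) - 1 * 2 ^ (J - (j + 1)) + 2 * 2 ^ (J - (e + 1)) * p =
      2 ^ (J - (j + 1)) * (2 * (a * (2 * p + 1) - 1) + 1) := fun p => by
    obtain ⟨a', ha'⟩ : ∃ a', a = a' + 1 := ⟨a - 1, by omega⟩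
    rw [hpow, ha', show 2 * ((a' + 1) * (2 * p + 1) - 1) + 1 =
        2 * a' + 1 + 2 * (2 * (a' + 1)) * p by
      rw [show (a' + 1) * (2 * p + 1) = a' + 2 * (a' + 1) * p + 1 by ring, Nat.add_sub_cancel]
      ring, show 1 * (2 ^ (J - (j + 1)) * (2 * (a' + 1))) =
        2 ^ (J - (j + 1)) * (2 * a' + 1) + 1 * 2 ^ (J - (j + 1)) by ring, Nat.add_sub_cancel]
    ring
  have hs0 : (samples (Real.sqrt (2 ^ (J - (j + 1)))) (2 * 2 ^ (J - (e + 1))) w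
      (1 * 2 ^ (J - (e + 1)) + 1 * 2 ^ (J - (j + 1)))).run y =
      ⟨tab w fun p => c2 (2 * 2 ^ j) g (2 * (a * (2 * p + 1)) + 1), 5 * w + 1,
        (List.range w).map fun p => 2 ^ (J - (j + 1)) * (2 * (a * (2 * p + 1)) + 1)⟩ := by
    rw [run_samples]
    simp only [hi0]
    congr 1
    refine tab_congr fun p hp => (hsamp _ ?_).2
    have := hbound p hp
    rw [pow_succ']; omega
  have hs1 : (samples (Real.sqrt (2 ^ (J - (j + 1)))) (2 * 2 ^ (J - (e + 1))) w
      (1 * 2 ^ (J - (e + 1)) - 1 * 2 ^ (J - (j + 1)))).run y =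
      ⟨tab w fun p => c2 (2 * 2 ^ j) g (2 * (a * (2 * p + 1) - 1) + 1), 5 * w + 1,
        (List.range w).map fun p => 2 ^ (J - (j + 1)) * (2 * (a * (2 * p + 1) - 1) + 1)⟩ := by
    rw [run_samples]
    simp only [hi1]
    congr 1
    refine tab_congr fun p hp => (hsamp _ ?_).2
    have := hbound p hp
    rw [pow_succ']; omega
  obtain ⟨T, hT, hIV⟩ := run_dctIV_tab y e
  rw [← hw] at hT hIV
  obtain ⟨t, ht, hsign⟩ := run_sign y (j - (e + 1)) (1 / 2 * Real.sqrt (2 ^ (j - (e + 1))))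
  rw [← ha] at hsign
  have hz := append_zeros_eq_tab hB hlen hmt hwn
  -- the antisymmetric part
  have hD : ∀ r < w, (-1) ^ r * 1 * (c4 w (fun p => c2 (2 * 2 ^ j) g
        (2 * (a * (2 * (w - 1 - p) + 1)) + 1) -
        c2 (2 * 2 ^ j) g (2 * (a * (2 * (w - 1 - p) + 1) - 1) + 1)) r /
      Real.cos (((1 : ℕ) + 2 * (r : ℝ)) * Real.pi / (4 * 2 ^ j : ℕ))) =
      (-1) ^ a * (1 / Real.sqrt a) * (g (2 ^ j - 1 - r) - g (2 ^ j + r)) := by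
    intro r hr
    rw [c4_odd_sub hn ha0 h1 h2 hr]
    have hc := (cos_angle_pos (show r < 2 ^ j by omega)).ne'
    rw [show ((1 : ℕ) + 2 * (r : ℝ)) * Real.pi / (4 * 2 ^ j : ℕ) =
      (2 * r + 1) * Real.pi / (4 * (2 ^ j : ℕ)) by push_cast; ring]
    have hs : ((-1 : ℝ) ^ r) * (-1) ^ r = 1 := by rw [← pow_add, Even.neg_one_pow ⟨r, rfl⟩]
    field_simp
    rw [sq, hs]; ring
  -- half the difference plus half the sum of mirrored entries
  have hz0 : (tab w fun i => (-1) ^ a * (1 / 2 * Real.sqrt (2 ^ (j - (e + 1)))) *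
      ((-1) ^ (w - 1 - i) * 1 * (c4 w (fun p => c2 (2 * 2 ^ j) g
        (2 * (a * (2 * (w - 1 - p) + 1)) + 1) -
        c2 (2 * 2 ^ j) g (2 * (a * (2 * (w - 1 - p) + 1) - 1) + 1)) (w - 1 - i) /
      Real.cos (((1 : ℕ) + 2 * ((w - 1 - i : ℕ) : ℝ)) * Real.pi / (4 * 2 ^ j : ℕ)))) +
      1 / 2 * f (2 ^ j - w + i)) = tab w fun i => g (2 ^ j - w + i) := by
    refine tab_congr fun i hi => ?_
    have hs : ((-1 : ℝ) ^ a) * (-1) ^ a = 1 := by rw [← pow_add, Even.neg_one_pow ⟨a, rfl⟩]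
    have hsa : Real.sqrt a ≠ 0 := by
      have : (0 : ℝ) < a := by exact_mod_cast ha0
      positivity
    rw [hD _ (by omega), hf, reflPeriod_eq_reflFold x hj, reflFold_of_lt _ (by omega), ← hg,
      show 2 ^ j - 1 - (w - 1 - i) = 2 ^ j - w + i by omega,
      show 2 * 2 ^ j - 1 - (2 ^ j - w + i) = 2 ^ j + (w - 1 - i) by omega,
      show ((2 : ℝ) ^ (j - (e + 1))) = (a : ℝ) by rw [ha]; push_cast; rfl]
    field_simp
    rw [sq, hs]; ring
  have hthr : (tab w fun i => if ε < |g (2 ^ j - w + i)| then g (2 ^ j - w + i) else 0) =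
      tab w fun i => g (2 ^ j - w + i) := by
    refine tab_congr fun i hi => ?_
    split_ifs with h
    · rfl
    · by_contra h'
      exact h (hbig _ (Ne.symm h'))
  have hboth : (tab (w + w) fun i => if i < w then g (2 ^ j - w + i) else
      f (2 ^ j - w + (w - 1 - (i - w))) - g (2 ^ j - w + (w - 1 - (i - w)))) =
      tab (w + w) fun i => g (2 ^ j - w + i) := by
    refine tab_congr fun i hi => ?_
    split_ifs with h
    · rfl
    · rw [hf, reflPeriod_eq_reflFold x hj, reflFold_of_lt _ (by omega), ← hg, add_sub_cancel_left]
      congr 1; omega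
  obtain ⟨B', s', hfind, hs', hB'⟩ := run_findSupport y (2 ^ j - w) (w + w) (f := g) hε
    (fun k hk => h1 k (by omega)) (fun k hk => h2 k (by omega)) hbig hne
  have hrun : (stepCollision J ε j B).run y = (stepCollision J ε j B).run y := rfl
  conv at hrun =>
    rhs
    rw [stepCollision]
    simp only [run_bind, run_tick, run_nadd, run_nsub, run_sqrtTwoPow, run_shl, run_clog,
      one_mul (2 ^ j), ← he, run_zeros, run_append, List.length_replicate]
    simp only [ite_bind, run_bind, one_mul w, ← hw, hz, hs0, hs1, run_zipWith_rsub, tab_zipWith,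
      run_rev, List.append_nil, tab_reverse, hIV, run_signedSec_tab, run_rdiv, run_rmul, run_nlt,
      hsign, run_zipWith_combine, hz0, run_map_threshold, tab_map, hthr, tab_append, hboth, hfind,
      run_append, tab_length, List.nil_append, run_nsub, min_self]
  refine ⟨_, _, _, hrun, ?_, ?_, ?_, hB', ?_⟩
  · have hT' : T ≤ (41 * Nat.clog 2 M + 17) * 2 ^ Nat.clog 2 M :=
      hT.trans (Nat.mul_le_mul (by omega) hwM)
    have hv := hB.vals_length
    rw [add_mul] at hT' ⊢
    rw [hv]
    have hp : 2 * (2 ^ j - B.first - B.len) + 2 * B.len + 4 * (w - (2 ^ j - B.first)) ≤ 4 * w := by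
      omega
    linarith
  · simp only [List.length_append, List.length_map, List.length_range]
    omega
  · intro i hi
    simp only [List.mem_append, List.mem_map, List.mem_range] at hi
    rcases hi with ⟨p, hp, rfl⟩ | ⟨p, hp, rfl⟩
    all_goals
      refine (hsamp _ ?_).1
      have := hbound p hp
      rw [pow_succ']; omega
  · have h3 := hsupp _ hB'.first_ne
    rw [pow_succ']
    exact h3

end SparseDCT

namespace SparseDCT
open Prog

/-! ### The iteration over the levels -/

section

variable {J : ℕ} {x : Fin (2 ^ J) → ℝ} {μ ν : Fin (2 ^ J)} {m M : ℕ}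

/-- If the support has the distance `M` from the beginning and from the end, then this remains so,
and there is no collision at any later level. -/
theorem run_levels_of_lt (h : HasShortSupport x μ ν m) (hev : Even m → x μ + x ν ≠ 0)
    (hmM : m ≤ M) (ε : ℝ) (r : ℕ) {j : ℕ} {B : Block} (hj : j + r = J) (hL : startLevel J M ≤ j)
    (hB : B.Represents (reflPeriod x j)) (h1 : B.first + M < 2 ^ j) (h2 : M < B.first + B.len) :
    ∃ B' s S, (levels J M ε r j B).run (zeroExtend (dctII x)) = ⟨B', s, S⟩ ∧
      s ≤ r * (18 * m + 32) + 1 ∧ S.length ≤ r * m ∧ (∀ i ∈ S, i < 2 ^ J) ∧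
      B'.Represents (reflPeriod x J) := by
  induction r generalizing j B with
  | zero =>
    obtain rfl : j = J := hj
    exact ⟨B, 1, [], by simp [levels, run_bind, run_tick, run_pure], by simp, by simp, by simp, hB⟩
  | succ r ih =>
    have hlen := (isShort_reflPeriod h hev hmM (by omega) hL).len_le hB
    obtain ⟨B', s, S, hrun, hs, hS, hSJ, hB', hlen', hf⟩ := run_stepNoCollision (by omega) hmM hB h1
      (unfolds_reflPeriod h hev hmM (by omega) hL)
    have hpow : 2 ^ (j + 1) = 2 * 2 ^ j := pow_succ' 2 j
    obtain ⟨B'', s', S', hrun', hs', hS', hSJ', hB''⟩ := ih (j := j + 1) (B := B') (by omega)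
      (by omega) hB' (by omega) (by omega)
    refine ⟨B'', 5 + s + s', S ++ S', ?_, ?_, ?_, ?_, hB''⟩
    · have hc : B.first + M < 1 * 2 ^ j := by omega
      simp only [levels, run_bind, run_tick, run_shl, run_nadd, run_nlt, hc, decide_true, if_true,
        hrun, hrun', List.nil_append, Outcome.mk.injEq, true_and, and_true]
      ring
    · rw [add_mul]; omega
    · rw [List.length_append, add_mul]; omega
    · intro i hi
      exact (List.mem_append.1 hi).elim (hSJ i) (hSJ' i)

/-- The iteration meets at most one collision. -/
theorem run_levels (h : HasShortSupport x μ ν m) (hev : Even m → x μ + x ν ≠ 0)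
    (hmM : m ≤ M) {ε : ℝ} (hε : 0 ≤ ε) (hbig : ∀ j, startLevel J M ≤ j → j ≤ J →
      ∀ k, reflPeriod x j k ≠ 0 → ε < |reflPeriod x j k|)
    (r : ℕ) {j : ℕ} {B : Block} (hj : j + r = J) (hL : startLevel J M ≤ j)
    (hB : B.Represents (reflPeriod x j)) :
    ∃ B' s S, (levels J M ε r j B).run (zeroExtend (dctII x)) = ⟨B', s, S⟩ ∧
      s ≤ r * (18 * m + 32) + 1 + min r 1 * ((41 * Nat.clog 2 M + 200) * 2 ^ Nat.clog 2 M) ∧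
      S.length ≤ r * m + min r 1 * (2 * 2 ^ Nat.clog 2 M) ∧ (∀ i ∈ S, i < 2 ^ J) ∧
      B'.Represents (reflPeriod x J) := by
  induction r generalizing j B with
  | zero =>
    obtain rfl : j = J := hj
    exact ⟨B, 1, [], by simp [levels, run_bind, run_tick, run_pure], by simp, by simp, by simp, hB⟩
  | succ r ih =>
    have hpow : 2 ^ (j + 1) = 2 * 2 ^ j := pow_succ' 2 j
    have hU := unfolds_reflPeriod h hev hmM (j := j) (by omega) hL
    have hlen := (isShort_reflPeriod h hev hmM (by omega) hL).len_le hB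
    rw [show min (r + 1) 1 = 1 by omega, one_mul, one_mul]
    by_cases hc : B.first + M < 1 * 2 ^ j
    · obtain ⟨B', s, S, hrun, hs, hS, hSJ, hB', -⟩ :=
        run_stepNoCollision (by omega) hmM hB (by omega) hU
      obtain ⟨B'', s', S', hrun', hs', hS', hSJ', hB''⟩ := ih (j := j + 1) (by omega) (by omega) hB'
      refine ⟨B'', 5 + s + s', S ++ S', ?_, ?_, ?_, ?_, hB''⟩
      · simp only [levels, run_bind, run_tick, run_shl, run_nadd, run_nlt, hc, decide_true, if_true,
          hrun, hrun', List.nil_append, Outcome.mk.injEq, true_and, and_true]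
        ring
      · have := Nat.mul_le_mul_right ((41 * Nat.clog 2 M + 200) * 2 ^ Nat.clog 2 M)
          (min_le_right r 1)
        rw [add_mul r 1]; omega
      · have := Nat.mul_le_mul_right (2 * 2 ^ Nat.clog 2 M) (min_le_right r 1)
        rw [List.length_append, add_mul]; omega
      · intro i hi
        exact (List.mem_append.1 hi).elim (hSJ i) (hSJ' i)
    · have h2M := two_mul_le_two_pow hL (show j < J by omega)
      have hcl : Nat.clog 2 M + 1 ≤ j := by rw [startLevel] at hL; omega
      obtain ⟨B', s, S, hrun, hs, hS, hSJ, hB', h1, h2⟩ :=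
        run_stepCollision (M := M) (by omega) hcl hB (by omega) hU
          (isShort_reflPeriod h hev hmM (by omega) (by omega)).exists_ne hε
          (hbig (j + 1) (by omega) (by omega))
      have hlen' := hB'.len_pos
      obtain ⟨B'', s', S', hrun', hs', hS', hSJ', hB''⟩ := run_levels_of_lt h hev hmM ε r
        (j := j + 1) (by omega) (by omega) hB' (by omega) (by omega)
      refine ⟨B'', 5 + s + s', S ++ S', ?_, ?_, ?_, ?_, hB''⟩
      · simp only [levels, run_bind, run_tick, run_shl, run_nadd, run_nlt, hc, decide_false,
          Bool.false_eq_true, if_false, hrun, hrun', List.nil_append, Outcome.mk.injEq, true_and,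
          and_true]
        ring
      · rw [add_mul r 1]; omega
      · rw [List.length_append, add_mul]; omega
      · intro i hi
        exact (List.mem_append.1 hi).elim (hSJ i) (hSJ' i)

/-- Correctness of the algorithm, with explicit bounds. The terms with `min (J - L) 1` belong to
the possible collision and are absent if there is no iteration step. -/
theorem run_algorithm (h : HasShortSupport x μ ν m) (hev : Even m → x μ + x ν ≠ 0)
    (hmM : m ≤ M) {ε : ℝ} (hε : 0 ≤ ε) (hbig : ∀ j, startLevel J M ≤ j → j ≤ J →
      ∀ k, reflPeriod x j k ≠ 0 → ε < |reflPeriod x j k|) {L : ℕ} (hL : L = startLevel J M) :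
    ∃ B s S, (algorithm J M ε).run (zeroExtend (dctII x)) = ⟨B, s, S⟩ ∧
      s ≤ (41 * L + 20) * 2 ^ L + (J - L) * (18 * m + 32) + 16 +
        min (J - L) 1 * ((41 * Nat.clog 2 M + 200) * 2 ^ Nat.clog 2 M) ∧
      S.length ≤ 2 ^ L + (J - L) * m + min (J - L) 1 * (2 * 2 ^ Nat.clog 2 M) ∧
      (∀ i ∈ S, i < 2 ^ J) ∧ B.toVec (2 ^ J) = x := by
  have hLJ : L ≤ J := hL ▸ min_le_right _ _
  set y := zeroExtend (dctII x) with hy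
  set f := reflPeriod x L with hf
  have hsamp : (samples (Real.sqrt (2 ^ (J - L))) (1 * 2 ^ (J - L)) (1 * 2 ^ L) 0).run y =
      ⟨tab (2 ^ L) (c2 (2 ^ L) f), 5 * 2 ^ L + 1,
        (List.range (2 ^ L)).map fun i => 2 ^ (J - L) * i⟩ := by
    rw [run_samples]
    simp only [one_mul, zero_add]
    congr 1
    exact tab_congr fun k hk => (sqrt_mul_sample x hLJ hk).2
  obtain ⟨T, hT, hIII⟩ := run_dctIII_tab y L
  have hinv : tab (2 ^ L) (c3 (2 ^ L) (c2 (2 ^ L) f)) = tab (2 ^ L) fun i => f (0 + i) :=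
    tab_congr fun i hi => by rw [c3_c2 _ hi, zero_add]
  have hne := (isShort_reflPeriod h hev hmM hLJ hL.ge).exists_ne
  obtain ⟨B, s, hfind, hs, hB⟩ := run_findSupport y 0 (2 ^ L) (f := f) hε (by simp)
    (fun k hk => reflPeriod_of_ge x hLJ (by omega)) (hbig L hL.ge hLJ) hne
  obtain ⟨B', s', S', hlev, hs', hS', hSJ', hB'⟩ := run_levels h hev hmM hε hbig (J - L)
    (j := L) (by omega) hL.ge hB
  rw [← hy] at hlev
  have hrun : (algorithm J M ε).run y = ⟨B', s' + s + T + 5 * 2 ^ L + 10,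
      ((List.range (2 ^ L)).map fun i => 2 ^ (J - L) * i) ++ S'⟩ := by
    rcases lt_or_ge (Nat.clog 2 M + 1) J with hc | hc
    · have hL' : Nat.clog 2 M + 1 = L := by rw [hL, startLevel, min_eq_left hc.le]
      have hc' : L < J := hL' ▸ hc
      simp only [algorithm, run_bind, run_clog, run_nadd, run_nlt, hL', hc', decide_true, if_true,
        run_pure, run_nsub, run_sqrtTwoPow, run_shl, hsamp, hIII, hinv, hfind, hlev, List.nil_append,
        Outcome.mk.injEq, true_and, and_true]
      ring
    · have hL' : L = J := by rw [hL, startLevel, min_eq_right hc]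
      have hc' : ¬ Nat.clog 2 M + 1 < J := not_lt.2 hc
      clear_value f y
      subst hL'
      simp only [algorithm, run_bind, run_clog, run_nadd, run_nlt, hc', decide_false,
        Bool.false_eq_true, if_false, run_pure, run_nsub, run_sqrtTwoPow, run_shl, hsamp, hIII, hinv,
        hfind, hlev, List.nil_append, Outcome.mk.injEq, true_and, and_true]
      ring
  refine ⟨_, _, _, hrun, ?_, ?_, ?_, ?_⟩
  · rw [add_mul] at hT ⊢
    linarith
  · simp only [List.length_append, List.length_map, List.length_range]
    omega
  · intro i hi
    rcases List.mem_append.1 hi with hi | hi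
    · obtain ⟨k, hk, rfl⟩ := List.mem_map.1 hi
      exact (sqrt_mul_sample x hLJ (List.mem_range.1 hk)).1
    · exact hSJ' i hi
  · funext k
    rw [← zeroExtend_val x k, ← reflPeriod_top, hB'.apply]
    rfl

end

end SparseDCT

/-! ### The asymptotic bounds -/

theorem two_pow_clog_le {M : ℕ} (hM : 1 ≤ M) : 2 ^ Nat.clog 2 M ≤ 2 * M := by
  rcases hM.eq_or_lt with rfl | hM
  · simp
  · have h1 := Nat.pow_pred_clog_lt_self (b := 2) (by norm_num) hM
    have h2 : 0 < Nat.clog 2 M := Nat.clog_pos (by norm_num) hM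
    obtain ⟨c, hc⟩ := Nat.exists_eq_succ_of_ne_zero h2.ne'
    rw [hc, Nat.pred_succ] at h1
    rw [hc, Nat.succ_eq_add_one, pow_succ']
    omega

theorem clog_le_logb_add_one {M : ℕ} (hM : 1 ≤ M) :
    (Nat.clog 2 M : ℝ) ≤ Real.logb 2 M + 1 := by
  have h0 : (0 : ℝ) < M := by exact_mod_cast hM
  have h : ((2 : ℝ) ^ Nat.clog 2 M) ≤ 2 * M := by exact_mod_cast two_pow_clog_le hM
  have h1 := Real.logb_le_logb_of_le (b := 2) (by norm_num) (by positivity) h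
  rw [Real.logb_mul (by norm_num) h0.ne', Real.logb_pow, Real.logb_self_eq_one (by norm_num)] at h1
  linarith

theorem logb_le_clog {M : ℕ} (hM : 1 ≤ M) : Real.logb 2 M ≤ Nat.clog 2 M := by
  have h0 : (0 : ℝ) < M := by exact_mod_cast hM
  have h : (M : ℝ) ≤ (2 : ℝ) ^ Nat.clog 2 M := by
    exact_mod_cast Nat.le_pow_clog (by norm_num) M
  have h1 := Real.logb_le_logb_of_le (b := 2) (by norm_num) h0 h
  rwa [Real.logb_pow, Real.logb_self_eq_one (by norm_num), mul_one] at h1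

theorem logb_two_pow_div {M : ℕ} (hM : 1 ≤ M) (J : ℕ) :
    Real.logb 2 ((2 : ℝ) ^ J / M) = J - Real.logb 2 M := by
  have h0 : (0 : ℝ) < M := by exact_mod_cast hM
  rw [Real.logb_div (by positivity) h0.ne', Real.logb_pow, Real.logb_self_eq_one (by norm_num),
    mul_one]

theorem logb_two_le {t : ℝ} (ht : 0 < t) : Real.logb 2 t ≤ 3 / 4 * t := by
  have h2 := Real.log_two_gt_d9
  have h2' := Real.log_two_lt_d9
  have h := Real.log_le_sub_one_of_pos (show 0 < t / 2 by positivity)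
  rw [Real.log_div ht.ne' (by norm_num)] at h
  rw [Real.logb, div_le_iff₀ (by linarith)]
  nlinarith

/-- If the iteration consists of a single transform of the full length, its length is bounded by
the asymptotic expressions, even where `M` exceeds this length and the logarithm of `2 ^ J / M` is
negative. -/
theorem bounds_of_le_clog {J m M : ℕ} (hJ : 1 ≤ J) (hm : 1 ≤ m) (hmM : m ≤ M) (hmJ : m ≤ 2 ^ J)
    (h : J ≤ Nat.clog 2 M + 1) :
    (J : ℝ) * 2 ^ J ≤ 12 * (M * Real.logb 2 M + m * (J - Real.logb 2 M)) ∧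
      (2 : ℝ) ^ J ≤ 4 * (M + m * (J - Real.logb 2 M)) := by
  have hM0 : 1 ≤ M := by omega
  have hJr : (1 : ℝ) ≤ J := by exact_mod_cast hJ
  have hmr : (1 : ℝ) ≤ m := by exact_mod_cast hm
  have hmMr : (m : ℝ) ≤ M := by exact_mod_cast hmM
  have hmJr : (m : ℝ) ≤ 2 ^ J := by exact_mod_cast hmJ
  have hcr : (J : ℝ) ≤ Nat.clog 2 M + 1 := by exact_mod_cast h
  have hcl := clog_le_logb_add_one hM0
  have hM0r : (0 : ℝ) < M := by linarith
  have hN : (0 : ℝ) < 2 ^ J := by positivity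
  have hpow : (2 : ℝ) ^ J ≤ 4 * M := by
    have h1 : 2 ^ J ≤ 2 ^ (Nat.clog 2 M + 1) := Nat.pow_le_pow_right (by norm_num) h
    have h2 := two_pow_clog_le hM0
    rw [pow_succ'] at h1
    exact_mod_cast (by omega : 2 ^ J ≤ 4 * M)
  have hlam := logb_two_pow_div hM0 J
  rcases le_or_gt (M : ℝ) (2 ^ J) with hMN | hMN
  · have hl : 0 ≤ (J : ℝ) - Real.logb 2 M := by
      rw [← hlam]
      exact Real.logb_nonneg (by norm_num) ((one_le_div hM0r).2 hMN)
    have hml : 0 ≤ (m : ℝ) * (J - Real.logb 2 M) := by positivity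
    refine ⟨?_, by linarith⟩
    rcases hM0.eq_or_lt with rfl | hM2
    · have hJ1 : J = 1 := by simp at h; omega
      subst hJ1
      simp
      linarith
    · have hlg : 1 ≤ Real.logb 2 M := by
        rw [Real.le_logb_iff_rpow_le (by norm_num) hM0r, Real.rpow_one]
        exact_mod_cast hM2
      have : (J : ℝ) * 2 ^ J ≤ (3 * Real.logb 2 M) * (4 * M) := by
        gcongr; linarith
      linarith
  · have hlg : (J : ℝ) ≤ Real.logb 2 M := by
      have : Real.logb 2 ((2 : ℝ) ^ J / M) ≤ 0 :=
        Real.logb_nonpos (by norm_num) (by positivity) ((div_le_one hM0r).2 hMN.le)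
      linarith
    constructor
    · nlinarith [mul_nonneg (sub_nonneg.2 hmMr) (sub_nonneg.2 hlg),
        mul_le_mul_of_nonneg_right hMN.le (show (0 : ℝ) ≤ J by linarith)]
    -- with `t = M / 2 ^ J`, the bracket is at least `2 ^ J * (t - log₂ t) ≥ M / 4`
    · have ht := logb_two_le (show 0 < (M : ℝ) / 2 ^ J by positivity)
      rw [Real.logb_div hM0r.ne' hN.ne', Real.logb_pow, Real.logb_self_eq_one (by norm_num),
        mul_one] at ht
      have h1 : (2 : ℝ) ^ J * (Real.logb 2 M - J) ≤ 3 / 4 * M := by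
        calc (2 : ℝ) ^ J * (Real.logb 2 M - J) ≤ 2 ^ J * (3 / 4 * (M / 2 ^ J)) := by gcongr
          _ = 3 / 4 * M := by field_simp
      have h2 : (m : ℝ) * (Real.logb 2 M - J) ≤ 2 ^ J * (Real.logb 2 M - J) := by
        gcongr
      linarith

/-- If there are iteration steps, their number and the cost of the transforms of length `2 ^ ⌈log₂
M⌉` are bounded by the asymptotic expressions. For `M = 1` the term `M log M` vanishes, and the
constant cost of the transforms is absorbed by the other term, which is at least `1`. -/
theorem bounds_of_clog_lt {J m M : ℕ} (hm : 1 ≤ m) (hM : 1 ≤ M) (h : Nat.clog 2 M + 1 < J) :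
    (1 ≤ (J : ℝ) - Real.logb 2 M) ∧
    ((J - (Nat.clog 2 M + 1) : ℕ) : ℝ) ≤ J - Real.logb 2 M ∧
    (Nat.clog 2 M + 1 : ℝ) * 2 ^ Nat.clog 2 M ≤
      6 * (M * Real.logb 2 M + m * (J - Real.logb 2 M)) := by
  have hmr : (1 : ℝ) ≤ m := by exact_mod_cast hm
  have hM0r : (0 : ℝ) < M := by exact_mod_cast hM
  have hcl := clog_le_logb_add_one hM
  have hcl' := logb_le_clog hM
  have hr : (Nat.clog 2 M : ℝ) + 1 < J := by exact_mod_cast h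
  have hW : (2 : ℝ) ^ Nat.clog 2 M ≤ 2 * M := by exact_mod_cast two_pow_clog_le hM
  have h1 : 1 ≤ (J : ℝ) - Real.logb 2 M := by linarith
  have hml : 1 ≤ (m : ℝ) * (J - Real.logb 2 M) := by nlinarith
  refine ⟨h1, ?_, ?_⟩
  · rw [Nat.cast_sub h.le]; push_cast; linarith
  · rcases hM.eq_or_lt with rfl | hM2
    · simp at hml ⊢
      linarith
    · have hlg : 1 ≤ Real.logb 2 M := by
        rw [Real.le_logb_iff_rpow_le (by norm_num) hM0r, Real.rpow_one]
        exact_mod_cast hM2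
      have : (Nat.clog 2 M + 1 : ℝ) * 2 ^ Nat.clog 2 M ≤ (3 * Real.logb 2 M) * (2 * M) := by
        gcongr; linarith
      linarith

theorem mainTheorem3 :
    ∃ C : ℝ, ∀ (J : ℕ), 1 ≤ J → ∀ (x : Fin (2 ^ J) → ℝ) (μ ν : Fin (2 ^ J)) (m M : ℕ) (ε : ℝ),
      HasShortSupport x μ ν m →
      (Even m → x μ + x ν ≠ 0) →
      m ≤ M →
      0 ≤ ε →
      (∀ j, startLevel J M ≤ j → j ≤ J →
        ∀ k, reflPeriod x j k ≠ 0 → ε < |reflPeriod x j k|) →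
      let r := (SparseDCT.algorithm J M ε).run (zeroExtend (dctII x))
      r.val.toVec (2 ^ J) = x ∧
      (r.steps : ℝ) ≤
        C * ((M : ℝ) * Real.logb 2 M + (m : ℝ) * Real.logb 2 ((2 : ℝ) ^ J / (M : ℝ))) ∧
      (r.samples.length : ℝ) ≤
        C * ((M : ℝ) + (m : ℝ) * Real.logb 2 ((2 : ℝ) ^ J / (M : ℝ))) ∧
      (∀ i ∈ r.samples, i < 2 ^ J) := by
  refine ⟨3000, fun J hJ x μ ν m M ε h hev hmM hε hbig => ?_⟩
  have hm : 1 ≤ m := by have := h.length; have := h.le; omega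
  have hmJ : m ≤ 2 ^ J := by have := h.length; have := ν.2; omega
  have hM : 1 ≤ M := by omega
  have hmr : (1 : ℝ) ≤ m := by exact_mod_cast hm
  rw [logb_two_pow_div hM]
  obtain ⟨B, s, S, hrun, hs, hS, hSJ, hB⟩ := SparseDCT.run_algorithm h hev hmM hε hbig rfl
  simp only [hrun]
  refine ⟨hB, ?_, ?_, hSJ⟩
  all_goals
    rcases le_or_gt J (Nat.clog 2 M + 1) with hc | hc
  · obtain ⟨h1, -⟩ := bounds_of_le_clog hJ hm hmM hmJ hc
    rw [startLevel, min_eq_right hc, Nat.sub_self] at hs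
    have h2 : s ≤ 77 * (J * 2 ^ J) := by
      have h3 := Nat.le_mul_of_pos_left (2 ^ J) hJ
      have h4 := Nat.one_le_two_pow (n := J)
      rw [Nat.zero_min, zero_mul, zero_mul, add_mul, mul_assoc] at hs
      omega
    have h3 : (s : ℝ) ≤ 77 * (J * 2 ^ J) := by exact_mod_cast h2
    have : (0 : ℝ) ≤ J * 2 ^ J := by positivity
    linarith
  · obtain ⟨h1, h2, h3⟩ := bounds_of_clog_lt hm hM hc
    rw [startLevel, min_eq_left hc.le, min_eq_right (by omega), one_mul] at hs
    set r := J - (Nat.clog 2 M + 1)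
    have h4 : s ≤ 323 * ((Nat.clog 2 M + 1) * 2 ^ Nat.clog 2 M) + 50 * (m * r) + 16 := by
      have : r ≤ m * r := Nat.le_mul_of_pos_left r hm
      rw [pow_succ'] at hs
      generalize 2 ^ Nat.clog 2 M = W at hs ⊢
      generalize Nat.clog 2 M = c at hs ⊢
      have := Nat.zero_le (c * W)
      linarith
    have h5 : (s : ℝ) ≤ 323 * ((Nat.clog 2 M + 1) * 2 ^ Nat.clog 2 M) + 50 * (m * r) + 16 := by
      exact_mod_cast h4
    have h6 : (m : ℝ) * r ≤ m * (J - Real.logb 2 M) := by gcongr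
    have h7 : 1 ≤ (m : ℝ) * (J - Real.logb 2 M) := by nlinarith
    have h8 : 0 ≤ (M : ℝ) * Real.logb 2 M := by
      have := Real.logb_nonneg (b := 2) (by norm_num) (show (1 : ℝ) ≤ M by exact_mod_cast hM)
      positivity
    linarith
  · obtain ⟨-, h1⟩ := bounds_of_le_clog hJ hm hmM hmJ hc
    rw [startLevel, min_eq_right hc, Nat.sub_self] at hS
    have h2 : S.length ≤ 2 ^ J := by simpa using hS
    have h3 : (S.length : ℝ) ≤ 2 ^ J := by exact_mod_cast h2
    have : (0 : ℝ) < 2 ^ J := by positivity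
    linarith
  · obtain ⟨h1, h2, -⟩ := bounds_of_clog_lt hm hM hc
    rw [startLevel, min_eq_left hc.le, min_eq_right (by omega), one_mul] at hS
    set r := J - (Nat.clog 2 M + 1)
    have h4 : S.length ≤ 8 * M + m * r := by
      have := two_pow_clog_le hM
      rw [pow_succ', mul_comm r] at hS
      omega
    have h5 : (S.length : ℝ) ≤ 8 * M + m * r := by exact_mod_cast h4
    have h6 : (m : ℝ) * r ≤ m * (J - Real.logb 2 M) := by gcongr
    have h7 : 1 ≤ (m : ℝ) * (J - Real.logb 2 M) := by nlinarith
    have h8 : 0 ≤ (M : ℝ) := by positivity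
    linarith
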